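/- Let $\mathbb K=\mathbb R$ or $\mathbb C$ (over $\mathbb R$, $^*$ is the transpose), let $m\ge n$, $A\in\mathbb K^{m\times n}$, and let $\|\cdot\|$ be the 2-norm. Let $A=U\begin{pmatrix}\Sigma\\0\end{pmatrix}V^*$ be a singular value decomposition, with $U,V$ unitary and $\Sigma$ real, diagonal and nonnegative. Write $U=[U_n,\hat U]$ with $U_n$ the first $n$ columns. Put $S_A=\begin{pmatrix}0&A^*\\A&0\end{pmatrix}$, whose eigenvector matrix is the unitary matrix $Q=\frac1{\sqrt2}\begin{pmatrix}V&V&0\\U_n&-U_n&\sqrt2\,\hat U\end{pmatrix}$, with eigenvalues $\operatorname{diag}(\Sigma,-\Sigma,0)$. Let $0<a<b\le\|A\|$, $l(x)=x/\|A\|$ and $d\ge0$. Let $\phi_d=\sum_{j=0}^d\rho_{j,d}c_jT_j$ be the Chebyshev–Jackson series of the step function of $[l(a),l(b)]$. Here $T_j$ are the Chebyshev polynomials of the first kind, $c_0=\frac1\pi(\arccos l(a)-\arccos l(b))$, $c_j=\frac2{\pi j}(\sin(j\arccos l(a))-\sin(j\arccos l(b)))$ for $j>0$, and $$\rho_{j,d}=\frac{(d+2-j)\sin\frac{\pi}{d+2}\cos\frac{j\pi}{d+2}+\cos\frac{\pi}{d+2}\sin\frac{j\pi}{d+2}}{(d+2)\sin\frac{\pi}{d+2}}.$$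 Let $P=\phi_d(l(S_A))$. Let $n_{sv}$ be the number of singular values of $A$ in $[a,b]$ (with multiplicity) and let $n_{sv}\le p<m+n$. Label the eigenvalues $\lambda_1,\dots,\lambda_{m+n}$ of $S_A$, and correspondingly the columns $q_1,\dots,q_{m+n}$ of $Q$, so that $\lambda_1=\sigma_1,\dots,\lambda_{n_{sv}}=\sigma_{n_{sv}}$ are the singular values in $[a,b]$. For $i\le n_{sv}$ let $u_i,v_i$ be the corresponding columns of $U_n,V$. Put $\gamma_i=\phi_d(l(\lambda_i))$, and assume that $\gamma_1\ge\gamma_2\ge\dots\ge\gamma_{m+n}$ and $\gamma_i>\gamma_{p+1}$ for $i\le n_{sv}$ (which holds for a suitable labeling when $d$ is large enough that the $\gamma_i$ of the desired singular values exceed all others). Put $Q_p=[q_1,\dots,q_p]$ and $Q_{p,\perp}=[q_{p+1},\dots,q_{m+n}]$. The algorithm starts from $\tilde Q^{(0)}\in\mathbb K^{(m+n)\times p}$ with orthonormal columns. For $k=1,2,\dots$ it computes a thin QR decomposition $P\tilde Q^{(k-1)}=\tilde Q^{(k)}R^{(k)}$ and thin QR decompositions $[I_n,0]\tilde Q^{(k)}=Q_1^{(k)}R_1^{(k)}$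 and $[0,I_m]\tilde Q^{(k)}=Q_2^{(k)}R_2^{(k)}$. It then computes a singular value decomposition $(Q_2^{(k)})^*AQ_1^{(k)}=\bar U^{(k)}\operatorname{diag}(\tilde\sigma_1^{(k)},\dots,\tilde\sigma_p^{(k)})(\bar V^{(k)})^*$ (in any order). Let $\tilde u_i^{(k)},\tilde v_i^{(k)}$ be the $i$-th columns of $Q_2^{(k)}\bar U^{(k)}$ and $Q_1^{(k)}\bar V^{(k)}$. Assume that $Q_p^*\tilde Q^{(0)}$ is invertible and put $E^{(0)}=Q_{p,\perp}^*\tilde Q^{(0)}(Q_p^*\tilde Q^{(0)})^{-1}$. Let $P^{(k)}$ be the orthogonal projector onto the column space of $\begin{pmatrix}Q_1^{(k)}&0\\0&Q_2^{(k)}\end{pmatrix}$, let $\alpha^{(k)}=\|P^{(k)}S_A(I-P^{(k)})\|$, and let $\eta_i^{(k)}=\min_{j\ne i}|\sigma_i-\tilde\sigma_j^{(k)}|$ (with $\alpha^{(k)}/\eta_i^{(k)}=0$ if $p=1$). Assume that each singular value of $A$ in $[a,b]$ is simple. Then for every $k\ge1$ and every $i\le n_{sv}$ such that $\tilde\sigma_j^{(k)}\ne\sigma_i$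 for all $j\ne i$, one has $0\le\gamma_{p+1}/\gamma_i<1$ and $$\sin^2\angle(u_i,\tilde u_i^{(k)})+\sin^2\angle(v_i,\tilde v_i^{(k)})\le2\Bigl(1+\frac{(\alpha^{(k)})^2}{(\eta_i^{(k)})^2}\Bigr)\Bigl(\frac{\gamma_{p+1}}{\gamma_i}\Bigr)^{2k}\|E^{(0)}\|^2,$$ $$|\sigma_i-\tilde\sigma_i^{(k)}|\le2\|A\|\Bigl(1+\frac{(\alpha^{(k)})^2}{(\eta_i^{(k)})^2}\Bigr)\Bigl(\frac{\gamma_{p+1}}{\gamma_i}\Bigr)^{2k}\|E^{(0)}\|^2.$$ Here $\angle(x,y)$ is the acute angle between the lines spanned by $x$ and $y$. -/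

import Mathlib

open scoped Matrix Matrix.Norms.L2Operator

noncomputable section

namespace CJFeast

/-! Matrix norms are spectral norms (the scoped `Matrix.Norms.L2Operator` instances).
The scalar field `𝕜` is `ℝ` or `ℂ`; over `ℝ` the conjugate transpose is the transpose. -/

/-- The acute angle between (the lines spanned by) two vectors, in the Euclidean inner product. -/
def acuteAngle {𝕜 : Type*} [RCLike 𝕜] {ι : Type*} [Fintype ι] (x y : ι → 𝕜) : ℝ :=
  Real.arccos (‖inner 𝕜 (WithLp.toLp 2 x) (WithLp.toLp 2 y)‖ /
    (‖(WithLp.toLp 2 x : EuclideanSpace 𝕜 ι)‖ * ‖(WithLp.toLp 2 y : EuclideanSpace 𝕜 ι)‖))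

/-- `A = U (Σ; 0) Vᴴ` is a singular value decomposition, `Σ = diag (s 0, …, s (n-1))`
(the diagonal entries are in no particular order). -/
structure IsSVD {𝕜 : Type*} [RCLike 𝕜] {m n : ℕ} (A : Matrix (Fin m) (Fin n) 𝕜)
    (U : Matrix (Fin m) (Fin m) 𝕜) (s : Fin n → ℝ) (V : Matrix (Fin n) (Fin n) 𝕜) : Prop where
  U_unitary : U ∈ Matrix.unitaryGroup (Fin m) 𝕜
  V_unitary : V ∈ Matrix.unitaryGroup (Fin n) 𝕜
  s_nonneg : ∀ j, 0 ≤ s j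
  eq : A = U * (Matrix.of fun (i : Fin m) (j : Fin n) => if (i : ℕ) = (j : ℕ) then (s j : 𝕜) else 0)
    * Vᴴ

/-- `M = G R` is a thin QR decomposition: `G` has orthonormal columns, `R` is upper triangular. -/
structure IsThinQR {𝕜 : Type*} [RCLike 𝕜] {ι : Type*} [Fintype ι] {p : ℕ}
    (M G : Matrix ι (Fin p) 𝕜) (R : Matrix (Fin p) (Fin p) 𝕜) : Prop where
  orthonormal : Gᴴ * G = 1
  upper : ∀ i j : Fin p, j < i → R i j = 0
  eq : M = G * R

/-- The augmented matrix `[0, Aᴴ; A, 0]`. The first block of coordinates has size `n`. -/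
def augmented {𝕜 : Type*} [RCLike 𝕜] {m n : ℕ} (A : Matrix (Fin m) (Fin n) 𝕜) :
    Matrix (Fin n ⊕ Fin m) (Fin n ⊕ Fin m) 𝕜 :=
  Matrix.fromBlocks 0 Aᴴ A 0

/-- The first `n` columns of `U`. -/
def leftVecs {𝕜 : Type*} {m n : ℕ} (hmn : n ≤ m) (U : Matrix (Fin m) (Fin m) 𝕜) :
    Matrix (Fin m) (Fin n) 𝕜 :=
  U.submatrix id (Fin.castLE hmn)

/-- The last `m - n` columns of `U`. -/
def leftRest {𝕜 : Type*} {m n : ℕ} (hmn : n ≤ m) (U : Matrix (Fin m) (Fin m) 𝕜) :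
    Matrix (Fin m) (Fin (m - n)) 𝕜 :=
  U.submatrix id (fun j => ⟨n + j, by omega⟩)

/-- The orthogonal (unitary) eigenvector matrix
`(1/√2) [V, V, 0; Uₙ, -Uₙ, √2 Û]` of the augmented matrix. -/
def eigVecs {𝕜 : Type*} [RCLike 𝕜] {m n : ℕ} (hmn : n ≤ m)
    (U : Matrix (Fin m) (Fin m) 𝕜) (V : Matrix (Fin n) (Fin n) 𝕜) :
    Matrix (Fin n ⊕ Fin m) (Fin n ⊕ (Fin n ⊕ Fin (m - n))) 𝕜 :=
  (((√2 : ℝ) : 𝕜)⁻¹) • Matrix.fromBlocks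
    V (Matrix.fromCols V 0)
    (leftVecs hmn U) (Matrix.fromCols (-leftVecs hmn U) (((√2 : ℝ) : 𝕜) • leftRest hmn U))

/-- The eigenvalues `(Σ, -Σ, 0)` of the augmented matrix, in the order of the columns of
`eigVecs`. -/
def eigVals {m n : ℕ} (s : Fin n → ℝ) : Fin n ⊕ (Fin n ⊕ Fin (m - n)) → ℝ :=
  Sum.elim s (Sum.elim (fun j => -s j) (fun _ => 0))

/-- The Fourier coefficient `c_j` of the step function of `[a, b] ⊆ [-1, 1]`. -/
def chebCoeff (a b : ℝ) (j : ℕ) : ℝ :=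
  if j = 0 then (Real.arccos a - Real.arccos b) / Real.pi
  else 2 / Real.pi * ((Real.sin (j * Real.arccos a) - Real.sin (j * Real.arccos b)) / j)

/-- The Jackson damping factor `ρ_{j,d}`. -/
def jackson (d j : ℕ) : ℝ :=
  (((d : ℝ) + 2 - j) * Real.sin (Real.pi / (d + 2)) * Real.cos (j * Real.pi / (d + 2))
      + Real.cos (Real.pi / (d + 2)) * Real.sin (j * Real.pi / (d + 2)))
    / ((d + 2) * Real.sin (Real.pi / (d + 2)))

/-- The Chebyshev--Jackson polynomial series `φ_d = ∑_{j ≤ d} ρ_{j,d} c_j T_j` of degree `d` of the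
step function of `[a, b] ⊆ [-1, 1]`. -/
def cjSeries (a b : ℝ) (d : ℕ) : Polynomial ℝ :=
  ∑ j ∈ Finset.range (d + 1),
    Polynomial.C (jackson d j * chebCoeff a b j) * Polynomial.Chebyshev.T ℝ (j : ℤ)

/-- `φ_d (l (x))`, where `l (x) = x / ‖A‖` and `φ_d` belongs to the interval `[l (a), l (b)]`. -/
def filterVal {𝕜 : Type*} [RCLike 𝕜] {m n : ℕ} (A : Matrix (Fin m) (Fin n) 𝕜) (a b : ℝ) (d : ℕ)
    (x : ℝ) : ℝ :=
  (cjSeries (a / ‖A‖) (b / ‖A‖) d).eval (x / ‖A‖)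

/-- The approximate spectral projector `P = φ_d (l (S_A))`. -/
def approxProj {𝕜 : Type*} [RCLike 𝕜] {m n : ℕ} (A : Matrix (Fin m) (Fin n) 𝕜) (a b : ℝ) (d : ℕ) :
    Matrix (Fin n ⊕ Fin m) (Fin n ⊕ Fin m) 𝕜 :=
  Polynomial.aeval (((‖A‖⁻¹ : ℝ) : 𝕜) • augmented A) (cjSeries (a / ‖A‖) (b / ‖A‖) d)

/-- A run of the Chebyshev--Jackson FEAST SVD solver on the augmented matrix, with subspace
dimension `p`. Iteration `k` (`k = 1, 2, …`) computes
* subspace iteration and QR: `P Q̃⁽ᵏ⁻¹⁾ = Q̃⁽ᵏ⁾ R⁽ᵏ⁾`;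
* QR of the upper and lower parts: `[Iₙ, 0] Q̃⁽ᵏ⁾ = Q₁⁽ᵏ⁾ R₁⁽ᵏ⁾`, `[0, Iₘ] Q̃⁽ᵏ⁾ = Q₂⁽ᵏ⁾ R₂⁽ᵏ⁾`;
* the SVD of the projected matrix: `(Q₂⁽ᵏ⁾)ᴴ A Q₁⁽ᵏ⁾ = Ū⁽ᵏ⁾ diag (σ̃⁽ᵏ⁾) (V̄⁽ᵏ⁾)ᴴ`.
The values at index `0` of all sequences other than `Qt` play no role. -/
structure Run {𝕜 : Type*} [RCLike 𝕜] {m n : ℕ} (A : Matrix (Fin m) (Fin n) 𝕜) (a b : ℝ)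
    (d p : ℕ) where
  Qt : ℕ → Matrix (Fin n ⊕ Fin m) (Fin p) 𝕜
  R : ℕ → Matrix (Fin p) (Fin p) 𝕜
  Q₁ : ℕ → Matrix (Fin n) (Fin p) 𝕜
  R₁ : ℕ → Matrix (Fin p) (Fin p) 𝕜
  Q₂ : ℕ → Matrix (Fin m) (Fin p) 𝕜
  R₂ : ℕ → Matrix (Fin p) (Fin p) 𝕜
  Ubar : ℕ → Matrix (Fin p) (Fin p) 𝕜
  Vbar : ℕ → Matrix (Fin p) (Fin p) 𝕜
  /-- the Ritz values, in any order -/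
  ritzVal : ℕ → Fin p → ℝ
  init : (Qt 0)ᴴ * Qt 0 = 1
  iterate : ∀ k, 1 ≤ k → IsThinQR (approxProj A a b d * Qt (k - 1)) (Qt k) (R k)
  upper : ∀ k, 1 ≤ k → IsThinQR ((Qt k).toRows₁) (Q₁ k) (R₁ k)
  lower : ∀ k, 1 ≤ k → IsThinQR ((Qt k).toRows₂) (Q₂ k) (R₂ k)
  svd : ∀ k, 1 ≤ k → IsSVD ((Q₂ k)ᴴ * A * Q₁ k) (Ubar k) (ritzVal k) (Vbar k)

namespace Run

variable {𝕜 : Type*} [RCLike 𝕜] {m n : ℕ} {A : Matrix (Fin m) (Fin n) 𝕜} {a b : ℝ} {d p : ℕ}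

/-- The left Ritz vector `ũ_i⁽ᵏ⁾`, column `i` of `Q₂⁽ᵏ⁾ Ū⁽ᵏ⁾`. -/
def ritzLeft (r : Run A a b d p) (k : ℕ) (i : Fin p) : Fin m → 𝕜 := (r.Q₂ k * r.Ubar k).col i

/-- The right Ritz vector `ṽ_i⁽ᵏ⁾`, column `i` of `Q₁⁽ᵏ⁾ V̄⁽ᵏ⁾`. -/
def ritzRight (r : Run A a b d p) (k : ℕ) (i : Fin p) : Fin n → 𝕜 := (r.Q₁ k * r.Vbar k).col i

/-- The block diagonal matrix `diag (Q₁⁽ᵏ⁾, Q₂⁽ᵏ⁾)`, whose columns span `𝒲⁽ᵏ⁾`. -/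
def basisW (r : Run A a b d p) (k : ℕ) : Matrix (Fin n ⊕ Fin m) (Fin p ⊕ Fin p) 𝕜 :=
  Matrix.fromBlocks (r.Q₁ k) 0 0 (r.Q₂ k)

/-- The orthogonal projector onto `𝒲⁽ᵏ⁾`; see `projW_isHermitian`, `projW_mul_self`,
`range_projW`. -/
def projW (r : Run A a b d p) (k : ℕ) : Matrix (Fin n ⊕ Fin m) (Fin n ⊕ Fin m) 𝕜 :=
  r.basisW k * (r.basisW k)ᴴ

theorem basisW_orthonormal (r : Run A a b d p) {k : ℕ} (hk : 1 ≤ k) :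
    (r.basisW k)ᴴ * r.basisW k = 1 := by
  simp [basisW, Matrix.fromBlocks_conjTranspose, Matrix.fromBlocks_multiply,
    (r.upper k hk).orthonormal, (r.lower k hk).orthonormal]

theorem projW_isHermitian (r : Run A a b d p) (k : ℕ) : (r.projW k).IsHermitian := by
  simp [projW, Matrix.IsHermitian, Matrix.conjTranspose_mul]

theorem projW_mul_basisW (r : Run A a b d p) {k : ℕ} (hk : 1 ≤ k) :
    r.projW k * r.basisW k = r.basisW k := by
  rw [projW, Matrix.mul_assoc, r.basisW_orthonormal hk, Matrix.mul_one]

theorem projW_mul_self (r : Run A a b d p) {k : ℕ} (hk : 1 ≤ k) :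
    r.projW k * r.projW k = r.projW k := by
  conv_lhs => rw [projW, ← Matrix.mul_assoc, ← projW, r.projW_mul_basisW hk]
  rfl

theorem range_projW (r : Run A a b d p) {k : ℕ} (hk : 1 ≤ k) :
    LinearMap.range (r.projW k).mulVecLin = Submodule.span 𝕜 (Set.range (r.basisW k).col) := by
  rw [← Matrix.range_mulVecLin]
  apply le_antisymm
  · rw [projW, Matrix.mulVecLin_mul]
    exact LinearMap.range_comp_le_range _ _
  · conv_lhs => rw [← r.projW_mul_basisW hk, Matrix.mulVecLin_mul]
    exact LinearMap.range_comp_le_range _ _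

/-- `α⁽ᵏ⁾ = ‖P⁽ᵏ⁾ S_A (I - P⁽ᵏ⁾)‖`. -/
def alpha (r : Run A a b d p) (k : ℕ) : ℝ :=
  ‖r.projW k * augmented A * (1 - r.projW k)‖

/-- `η_i⁽ᵏ⁾ = min_{j ≠ i} |σ - σ̃_j⁽ᵏ⁾|`, to be used with `σ = σ_i`. For `p = 1` the minimum is over
the empty set; its value is then `0`, so that the quotient `α⁽ᵏ⁾ / η_i⁽ᵏ⁾` is `0`, in accordance with
the usual convention `min ∅ = ∞`. -/
def eta (r : Run A a b d p) (k : ℕ) (σ : ℝ) (i : Fin p) : ℝ :=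
  ⨅ j : {j : Fin p // j ≠ i}, |σ - r.ritzVal k j|

end Run

/-- The columns `q_1, …, q_p` (in the labeling `lab`) of the eigenvector matrix `Q`. -/
def firstCols {𝕜 ι κ : Type*} {N : ℕ} (Q : Matrix ι κ 𝕜) (lab : Fin N ≃ κ) (p : ℕ)
    (hp : p ≤ N) : Matrix ι (Fin p) 𝕜 :=
  Q.submatrix id (fun i => lab (Fin.castLE hp i))

/-- The columns `q_{p+1}, …, q_N` (in the labeling `lab`) of the eigenvector matrix `Q`. -/
def lastCols {𝕜 ι κ : Type*} {N : ℕ} (Q : Matrix ι κ 𝕜) (lab : Fin N ≃ κ) (p : ℕ) :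
    Matrix ι {i : Fin N // p ≤ (i : ℕ)} 𝕜 :=
  Q.submatrix id (fun i => lab i)

/-- `E⁽⁰⁾ = Q_{p,⊥}ᴴ Q̃⁽⁰⁾ (Q_pᴴ Q̃⁽⁰⁾)⁻¹`. -/
def errMat {𝕜 : Type*} [RCLike 𝕜] {ι κ : Type*} [Fintype ι] {p : ℕ}
    (Qp : Matrix ι (Fin p) 𝕜) (Qperp : Matrix ι κ 𝕜) (Qt : Matrix ι (Fin p) 𝕜) :
    Matrix κ (Fin p) 𝕜 :=
  Qperpᴴ * Qt * (Qpᴴ * Qt)⁻¹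

end CJFeast

end

/-! # Convergence of the Chebyshev--Jackson FEAST SVD solver

Four facts carry the proof.

*The filter is nonnegative.* The Jackson factors `ρ_{j,d}` are the normalized autocorrelations of
the sequence `sin ((k + 1) π / (d + 2))` (`jackson_eq`), so that the kernel
`1 + 2 ∑ ρ_{j,d} cos (j θ)` is a multiple of `|∑ₖ sin ((k + 1) π / (d + 2)) e^{ikθ}|²`
(`jacksonKernel_nonneg`). The Chebyshev--Jackson series of a step function is an average of
translates of this kernel, hence nonnegative on `[-1, 1]` (`cjSeries_eval_nonneg`). All eigenvalues
of `P` are therefore nonnegative, and `γ_j ≤ γ_{p+1}` bounds `|γ_j|` for `j > p`.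

*Subspace iteration.* The vector `y` with `Q_pᴴ Q̃⁽⁰⁾ y = γ_i^{-k} e_i` gives an element
`P ^ k Q̃⁽⁰⁾ y` of the column space of `Q̃⁽ᵏ⁾` whose squared distance from `q_i` is at most
`(γ_{p+1} / γ_i) ^ (2k) ‖E⁽⁰⁾‖²` (`exists_normSq_sub_pow_mulVec_le`). The triangular factors of the
QR decompositions need not be invertible for this (`Run.exists_pow_mul_eq`). As
`q_i = (v_i; u_i) / √2`, the squared distances of `v_i` from `span Q₁⁽ᵏ⁾` and of `u_i` from
`span Q₂⁽ᵏ⁾` add up to at most twice that bound.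

*Rayleigh--Ritz.* The components `c_j`, `d_j` of `v_i`, `u_i` along the Ritz vectors satisfy
`σ d_j - σ̃_j c_j = f_j` and `σ c_j - σ̃_j d_j = g_j`, where the vectors `f`, `g` come from the
residuals through the off-diagonal block of norm `α⁽ᵏ⁾`. As `|σ - σ̃_j| ≤ σ + σ̃_j`, solving this
system costs at most a factor `1 / η` for `j ≠ i` (`sq_sub_mul_le`), which bounds the sum of the two
squared sines (`one_sub_sq_add_one_sub_sq_le`).

*Ritz values.* The Ritz value `σ̃_i` is the nonnegative Rayleigh quotient of the two Ritz vectors,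
and its error is at most `‖A‖` times the sum of the squared sines (`abs_sub_rayleigh_le`).
-/

namespace CJFeast

/-! ### Nonnegativity of the Chebyshev--Jackson series -/

/-- Expansion of a squared modulus `|∑ aₖ e^{ikθ}|²` into a cosine polynomial. -/
theorem sq_sum_cos_add_sq_sum_sin (x : ℕ → ℝ) (θ : ℝ) (n : ℕ) :
    (∑ k ∈ Finset.range n, x k * Real.cos (k * θ)) ^ 2
        + (∑ k ∈ Finset.range n, x k * Real.sin (k * θ)) ^ 2
      = ∑ j ∈ Finset.range n, (if j = 0 then 1 else 2) * Real.cos (j * θ)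
          * ∑ k ∈ Finset.range (n - j), x k * x (k + j) := by
  induction n with
  | zero => simp
  | succ n ih =>
    have hcross : ∑ j ∈ Finset.range (n + 1), (if j = 0 then 1 else 2) * Real.cos (j * θ)
          * (x (n - j) * x n)
        = x n ^ 2 + 2 * (Real.cos (n * θ) * x n * ∑ k ∈ Finset.range n, x k * Real.cos (k * θ)
          + Real.sin (n * θ) * x n * ∑ k ∈ Finset.range n, x k * Real.sin (k * θ)) := by
      rw [← Finset.sum_range_reflect, Finset.sum_range_succ]
      simp only [Nat.add_sub_cancel, Nat.sub_self, if_true, Nat.cast_zero, zero_mul, Real.cos_zero]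
      rw [Finset.mul_sum, Finset.mul_sum, ← Finset.sum_add_distrib, Finset.mul_sum, add_comm]
      congr 1
      · simp; ring
      · refine Finset.sum_congr rfl fun k hk => ?_
        have hk' : k < n := Finset.mem_range.mp hk
        rw [if_neg (by omega), Nat.sub_sub_self hk'.le, Nat.cast_sub hk'.le, sub_mul,
          Real.cos_sub]
        ring
    have hsplit : ∑ j ∈ Finset.range (n + 1), (if j = 0 then 1 else 2) * Real.cos (j * θ)
          * ∑ k ∈ Finset.range (n + 1 - j), x k * x (k + j)
        = (∑ j ∈ Finset.range n, (if j = 0 then 1 else 2) * Real.cos (j * θ)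
          * ∑ k ∈ Finset.range (n - j), x k * x (k + j))
          + ∑ j ∈ Finset.range (n + 1), (if j = 0 then 1 else 2) * Real.cos (j * θ)
          * (x (n - j) * x n) := by
      have h0 : ∑ j ∈ Finset.range n, (if j = 0 then 1 else 2) * Real.cos (j * θ)
            * ∑ k ∈ Finset.range (n - j), x k * x (k + j)
          = ∑ j ∈ Finset.range (n + 1), (if j = 0 then 1 else 2) * Real.cos (j * θ)
            * ∑ k ∈ Finset.range (n - j), x k * x (k + j) := by
        rw [Finset.sum_range_succ]; simp
      rw [h0, ← Finset.sum_add_distrib]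
      refine Finset.sum_congr rfl fun j hj => ?_
      have hj' : j ≤ n := Nat.lt_succ_iff.mp (Finset.mem_range.mp hj)
      rw [Nat.succ_sub hj', Finset.sum_range_succ, Nat.sub_add_cancel hj', mul_add]
    rw [hsplit, ← ih, hcross, Finset.sum_range_succ, Finset.sum_range_succ]
    linear_combination x n ^ 2 * Real.sin_sq_add_cos_sq (n * θ)

/-- A telescoping sum, by `2 sin α sin β = cos (β - α) - cos (β + α)` and
`2 sin h cos x = sin (x + h) - sin (x - h)`. -/
theorem sum_sin_mul_sin (h : ℝ) (j M : ℕ) :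
    2 * Real.sin h * ∑ k ∈ Finset.range M,
        Real.sin ((k + 1 : ℕ) * h) * Real.sin ((k + j + 1 : ℕ) * h)
      = M * Real.sin h * Real.cos (j * h)
        - (Real.sin ((2 * M + j + 1) * h) - Real.sin ((j + 1) * h)) / 2 := by
  induction M with
  | zero => simp
  | succ M ih =>
    rw [Finset.sum_range_succ, mul_add, ih]
    have e1 : (2 * (M : ℝ) + j + 1) * h = (((M + 1 : ℕ) * h) + ((M + j + 1 : ℕ) * h)) - h := by
      push_cast; ring
    have e2 : (2 * ((M + 1 : ℕ) : ℝ) + j + 1) * h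
        = (((M + 1 : ℕ) * h) + ((M + j + 1 : ℕ) * h)) + h := by
      push_cast; ring
    have e3 : (j : ℝ) * h = ((M + j + 1 : ℕ) * h) - ((M + 1 : ℕ) * h) := by
      push_cast; ring
    rw [e1, e2, e3]
    generalize ((M + 1 : ℕ) : ℝ) * h = α
    generalize ((M + j + 1 : ℕ) : ℝ) * h = β
    rw [Real.sin_sub, Real.sin_add _ h, Real.cos_sub, Real.cos_add]
    push_cast
    ring

/-- The Jackson factors are the normalized autocorrelations of the sequence
`sin ((k + 1) π / (d + 2))`. -/
theorem jackson_eq (d j : ℕ) (hj : j ≤ d) :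
    jackson d j = 2 / (d + 2) * ∑ k ∈ Finset.range (d + 1 - j),
      Real.sin ((k + 1 : ℕ) * (Real.pi / (d + 2)))
        * Real.sin ((k + j + 1 : ℕ) * (Real.pi / (d + 2))) := by
  have hd : (0 : ℝ) < d + 2 := by positivity
  have hs : 0 < Real.sin (Real.pi / (d + 2)) := by
    apply Real.sin_pos_of_pos_of_lt_pi (by positivity)
    rw [div_lt_iff₀ hd]
    nlinarith [Real.pi_pos, (Nat.cast_nonneg d : (0 : ℝ) ≤ d)]
  have key := sum_sin_mul_sin (Real.pi / (d + 2)) j (d + 1 - j)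
  set S := ∑ k ∈ Finset.range (d + 1 - j),
      Real.sin ((k + 1 : ℕ) * (Real.pi / (d + 2)))
        * Real.sin ((k + j + 1 : ℕ) * (Real.pi / (d + 2))) with hS
  have hrefl : Real.sin ((2 * ((d + 1 - j : ℕ) : ℝ) + j + 1) * (Real.pi / (d + 2)))
      = - Real.sin ((j + 1) * (Real.pi / (d + 2))) := by
    have : (2 * ((d + 1 - j : ℕ) : ℝ) + j + 1) * (Real.pi / (d + 2))
        = 2 * Real.pi - (j + 1) * (Real.pi / (d + 2)) := by
      rw [Nat.cast_sub (by omega)]; push_cast; field_simp; ring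
    rw [this, Real.sin_two_pi_sub]
  rw [hrefl, Nat.cast_sub (by omega)] at key
  have e : ((j : ℝ) + 1) * (Real.pi / (d + 2)) = j * (Real.pi / (d + 2)) + Real.pi / (d + 2) := by
    ring
  rw [e, Real.sin_add] at key
  push_cast at key
  rw [jackson, mul_div_assoc (j : ℝ), div_eq_iff (by positivity)]
  generalize Real.pi / ((d : ℝ) + 2) = h at *
  field_simp
  linear_combination -key

/-- The Jackson kernel is `2 / (d + 2)` times the squared modulus of a trigonometric polynomial. -/
theorem jacksonKernel_nonneg (d : ℕ) (θ : ℝ) :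
    0 ≤ ∑ j ∈ Finset.range (d + 1), (if j = 0 then 1 else 2) * jackson d j * Real.cos (j * θ) := by
  have h := sq_sum_cos_add_sq_sum_sin
    (fun k => Real.sin ((k + 1 : ℕ) * (Real.pi / (d + 2)))) θ (d + 1)
  have : ∑ j ∈ Finset.range (d + 1), (if j = 0 then 1 else 2) * jackson d j * Real.cos (j * θ)
      = 2 / (d + 2) * ((∑ k ∈ Finset.range (d + 1),
          Real.sin ((k + 1 : ℕ) * (Real.pi / (d + 2))) * Real.cos (k * θ)) ^ 2
        + (∑ k ∈ Finset.range (d + 1),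
          Real.sin ((k + 1 : ℕ) * (Real.pi / (d + 2))) * Real.sin (k * θ)) ^ 2) := by
    rw [h, Finset.mul_sum]
    refine Finset.sum_congr rfl fun j hj => ?_
    rw [jackson_eq d j (Nat.lt_succ_iff.mp (Finset.mem_range.mp hj))]
    ring
  rw [this]
  positivity

theorem chebCoeff_eq_integral (a b : ℝ) (j : ℕ) :
    chebCoeff a b j = ∫ θ in (Real.arccos b)..(Real.arccos a),
      (if j = 0 then 1 else 2) / Real.pi * Real.cos (j * θ) := by
  rw [intervalIntegral.integral_const_mul]
  rcases eq_or_ne j 0 with rfl | hj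
  · simp [chebCoeff]; ring
  · have hj' : (j : ℝ) ≠ 0 := by exact_mod_cast hj
    rw [intervalIntegral.integral_comp_mul_left _ hj', integral_cos, chebCoeff, if_neg hj,
      if_neg hj, smul_eq_mul]
    ring

/-- A Chebyshev--Jackson series of a step function is nonnegative on `[-1, 1]`: at `cos t` it is an
average of the translates by `±t` of the Jackson kernel. -/
theorem cjSeries_eval_nonneg {a b x : ℝ} (hab : a ≤ b) (d : ℕ) (hx : x ∈ Set.Icc (-1) 1) :
    0 ≤ (cjSeries a b d).eval x := by
  set t := Real.arccos x with ht
  have hxt : x = Real.cos t := (Real.cos_arccos hx.1 hx.2).symm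
  have h : (cjSeries a b d).eval x = ∫ θ in (Real.arccos b)..(Real.arccos a),
      (1 / (2 * Real.pi)) *
      ((∑ j ∈ Finset.range (d + 1), (if j = 0 then 1 else 2) * jackson d j * Real.cos (j * (θ + t)))
      + ∑ j ∈ Finset.range (d + 1),
        (if j = 0 then 1 else 2) * jackson d j * Real.cos (j * (θ - t))) := by
    simp only [← Finset.sum_add_distrib, Finset.mul_sum]
    rw [intervalIntegral.integral_finsetSum
      (fun j _ => (by fun_prop : Continuous _).intervalIntegrable _ _)]
    rw [cjSeries, Polynomial.eval_finsetSum]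
    refine Finset.sum_congr rfl fun j _ => ?_
    rw [Polynomial.eval_mul, Polynomial.eval_C, hxt, Polynomial.Chebyshev.T_real_cos,
      chebCoeff_eq_integral, ← intervalIntegral.integral_const_mul,
      ← intervalIntegral.integral_mul_const]
    congr 1
    funext θ
    rw [mul_add (j : ℝ), mul_sub (j : ℝ), Real.cos_add, Real.cos_sub]
    push_cast
    field_simp
    ring
  rw [h]
  refine intervalIntegral.integral_nonneg (Real.antitone_arccos hab) fun θ _ => ?_
  have := jacksonKernel_nonneg d (θ + t)
  have := jacksonKernel_nonneg d (θ - t)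
  have := Real.pi_pos
  positivity

/-! ### Squared norms and orthonormal columns -/

/-- The squared Euclidean norm of a coordinate vector. -/
noncomputable def normSq {𝕜 : Type*} [RCLike 𝕜] {ι : Type*} [Fintype ι] (x : ι → 𝕜) : ℝ :=
  ‖(WithLp.toLp 2 x : EuclideanSpace 𝕜 ι)‖ ^ 2

section normSq

variable {𝕜 : Type*} [RCLike 𝕜] {ι κ : Type*} [Fintype ι] [Fintype κ]

theorem normSq_eq_sum (x : ι → 𝕜) : normSq x = ∑ i, ‖x i‖ ^ 2 := by
  simp [normSq, EuclideanSpace.norm_sq_eq]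

theorem normSq_nonneg (x : ι → 𝕜) : 0 ≤ normSq x := sq_nonneg _

theorem ofReal_normSq (x : ι → 𝕜) : ((normSq x : ℝ) : 𝕜) = star x ⬝ᵥ x := by
  rw [normSq_eq_sum, dotProduct]
  push_cast
  exact Finset.sum_congr rfl fun i _ => (RCLike.conj_mul (x i)).symm

theorem normSq_smul (c : 𝕜) (x : ι → 𝕜) : normSq (c • x) = ‖c‖ ^ 2 * normSq x := by
  simp [normSq_eq_sum, mul_pow, Finset.mul_sum]

theorem normSq_sumElim (x : ι → 𝕜) (y : κ → 𝕜) :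
    normSq (Sum.elim x y) = normSq x + normSq y := by
  simp [normSq_eq_sum]

theorem normSq_mulVec_le [DecidableEq κ] (M : Matrix ι κ 𝕜) (x : κ → 𝕜) :
    normSq (M *ᵥ x) ≤ ‖M‖ ^ 2 * normSq x := by
  rw [normSq, normSq, ← mul_pow]
  exact pow_le_pow_left₀ (norm_nonneg _) (Matrix.l2_opNorm_mulVec M (WithLp.toLp 2 x)) 2

theorem normSq_mulVec_of_orthonormal [DecidableEq κ] {G : Matrix ι κ 𝕜} (hG : Gᴴ * G = 1)
    (x : κ → 𝕜) : normSq (G *ᵥ x) = normSq x := by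
  have : ((normSq (G *ᵥ x) : ℝ) : 𝕜) = ((normSq x : ℝ) : 𝕜) := by
    rw [ofReal_normSq, ofReal_normSq, Matrix.star_mulVec, ← Matrix.dotProduct_mulVec,
      Matrix.mulVec_mulVec, hG, Matrix.one_mulVec]
  exact_mod_cast this

/-- Pythagoras for a vector of the column space and a vector orthogonal to it. -/
theorem normSq_add_mulVec [DecidableEq κ] {G : Matrix ι κ 𝕜} (hG : Gᴴ * G = 1)
    {y : ι → 𝕜} (hy : Gᴴ *ᵥ y = 0) (x : κ → 𝕜) :
    normSq (y + G *ᵥ x) = normSq y + normSq x := by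
  have h1 : star y ⬝ᵥ G *ᵥ x = 0 := by
    rw [Matrix.dotProduct_mulVec, ← Matrix.conjTranspose_conjTranspose G, ← Matrix.star_mulVec, hy]
    simp
  have h2 : star (G *ᵥ x) ⬝ᵥ y = 0 := by
    rw [Matrix.star_mulVec, ← Matrix.dotProduct_mulVec, hy, dotProduct_zero]
  have : ((normSq (y + G *ᵥ x) : ℝ) : 𝕜) = ((normSq y + normSq x : ℝ) : 𝕜) := by
    rw [← normSq_mulVec_of_orthonormal hG x]
    rw [RCLike.ofReal_add, ofReal_normSq, ofReal_normSq, ofReal_normSq, star_add, add_dotProduct,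
      dotProduct_add,
      dotProduct_add, h1, h2]
    ring
  exact_mod_cast this

theorem conjTranspose_mulVec_residual [DecidableEq κ] {G : Matrix ι κ 𝕜} (hG : Gᴴ * G = 1)
    (x : ι → 𝕜) : Gᴴ *ᵥ (x - G *ᵥ (Gᴴ *ᵥ x)) = 0 := by
  rw [Matrix.mulVec_sub, Matrix.mulVec_mulVec _ Gᴴ, hG, Matrix.one_mulVec, sub_self]

theorem normSq_eq_residual_add [DecidableEq κ] {G : Matrix ι κ 𝕜} (hG : Gᴴ * G = 1)
    (x : ι → 𝕜) :
    normSq x = normSq (x - G *ᵥ (Gᴴ *ᵥ x)) + normSq (Gᴴ *ᵥ x) := by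
  rw [← normSq_add_mulVec hG (conjTranspose_mulVec_residual hG x), sub_add_cancel]

/-- The orthogonal projection is the best approximation from the column space. -/
theorem normSq_residual_le [DecidableEq κ] {G : Matrix ι κ 𝕜} (hG : Gᴴ * G = 1)
    (x : ι → 𝕜) (w : κ → 𝕜) :
    normSq (x - G *ᵥ (Gᴴ *ᵥ x)) ≤ normSq (x - G *ᵥ w) := by
  have : x - G *ᵥ w = (x - G *ᵥ (Gᴴ *ᵥ x)) + G *ᵥ (Gᴴ *ᵥ x - w) := by
    rw [Matrix.mulVec_sub]; abel
  rw [this, normSq_add_mulVec hG (conjTranspose_mulVec_residual hG x)]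
  linarith [normSq_nonneg (Gᴴ *ᵥ x - w)]

theorem normSq_single [DecidableEq ι] (i : ι) : normSq (Pi.single i (1 : 𝕜)) = 1 := by
  rw [normSq_eq_sum, Finset.sum_eq_single i]
  · simp
  · intro j _ hj; simp [hj]
  · simp

theorem normSq_col_of_orthonormal [DecidableEq κ] {G : Matrix ι κ 𝕜} (hG : Gᴴ * G = 1)
    (j : κ) : normSq (G.col j) = 1 := by
  rw [← Matrix.mulVec_single_one, normSq_mulVec_of_orthonormal hG, normSq_single]

/-- The squared norm of a column is at most the squared operator norm. -/
theorem normSq_col_le [DecidableEq κ] (M : Matrix ι κ 𝕜) (j : κ) :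
    normSq (M.col j) ≤ ‖M‖ ^ 2 := by
  have := normSq_mulVec_le M (Pi.single j 1)
  rwa [Matrix.mulVec_single_one, normSq_single, mul_one] at this

end normSq

/-! ### Spectral decomposition of the augmented matrix -/

section SVD

variable {𝕜 : Type*} [RCLike 𝕜] {m n : ℕ} (hmn : n ≤ m) {A : Matrix (Fin m) (Fin n) 𝕜}
  {U : Matrix (Fin m) (Fin m) 𝕜} {s : Fin n → ℝ} {V : Matrix (Fin n) (Fin n) 𝕜}

theorem leftVecs_orthonormal (hU : U ∈ Matrix.unitaryGroup (Fin m) 𝕜) :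
    (leftVecs hmn U)ᴴ * leftVecs hmn U = 1 := by
  have h : Uᴴ * U = 1 := Matrix.mem_unitaryGroup_iff'.mp hU
  rw [leftVecs, Matrix.conjTranspose_submatrix,
    ← Matrix.submatrix_mul _ _ _ _ _ Function.bijective_id, h]
  exact Matrix.submatrix_one _ (Fin.castLE_injective hmn)

theorem leftRest_orthonormal (hU : U ∈ Matrix.unitaryGroup (Fin m) 𝕜) :
    (leftRest hmn U)ᴴ * leftRest hmn U = 1 := by
  have h : Uᴴ * U = 1 := Matrix.mem_unitaryGroup_iff'.mp hU
  rw [leftRest, Matrix.conjTranspose_submatrix,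
    ← Matrix.submatrix_mul _ _ _ _ _ Function.bijective_id, h]
  refine Matrix.submatrix_one _ fun i j hij => ?_
  simpa [Fin.ext_iff] using hij

theorem leftVecs_mul_leftRest (hU : U ∈ Matrix.unitaryGroup (Fin m) 𝕜) :
    (leftVecs hmn U)ᴴ * leftRest hmn U = 0 := by
  have h : Uᴴ * U = 1 := Matrix.mem_unitaryGroup_iff'.mp hU
  rw [leftRest, leftVecs, Matrix.conjTranspose_submatrix,
    ← Matrix.submatrix_mul _ _ _ _ _ Function.bijective_id, h]
  ext i j
  have := i.2
  simp only [Matrix.submatrix_apply, Matrix.zero_apply]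
  exact Matrix.one_apply_ne (by simp [Fin.ext_iff]; omega)

theorem IsSVD.eq_thin (h : IsSVD A U s V) :
    A = leftVecs hmn U * Matrix.diagonal (fun j => (s j : 𝕜)) * Vᴴ := by
  conv_lhs => rw [h.eq]
  congr 1
  ext i j
  rw [Matrix.mul_apply, Matrix.mul_diagonal, Finset.sum_eq_single (Fin.castLE hmn j)]
  · simp [leftVecs]
  · intro l _ hl
    have : (l : ℕ) ≠ j := fun h => hl (Fin.ext h)
    simp [this]
  · simp

theorem IsSVD.mul_right (h : IsSVD A U s V) :
    A * V = leftVecs hmn U * Matrix.diagonal (fun j => (s j : 𝕜)) := by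
  have hV : Vᴴ * V = 1 := Matrix.mem_unitaryGroup_iff'.mp h.V_unitary
  conv_lhs => rw [h.eq_thin hmn]
  rw [Matrix.mul_assoc, hV, Matrix.mul_one]

theorem IsSVD.conjTranspose_eq (h : IsSVD A U s V) :
    Aᴴ = V * Matrix.diagonal (fun j => (s j : 𝕜)) * (leftVecs hmn U)ᴴ := by
  conv_lhs => rw [h.eq_thin hmn]
  rw [Matrix.conjTranspose_mul, Matrix.conjTranspose_mul, Matrix.conjTranspose_conjTranspose,
    Matrix.diagonal_conjTranspose, ← Matrix.mul_assoc]
  congr 3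
  ext j
  simp

theorem IsSVD.conjTranspose_mul_left (h : IsSVD A U s V) :
    Aᴴ * leftVecs hmn U = V * Matrix.diagonal (fun j => (s j : 𝕜)) := by
  rw [h.conjTranspose_eq hmn, Matrix.mul_assoc, leftVecs_orthonormal hmn h.U_unitary,
    Matrix.mul_one]

theorem IsSVD.conjTranspose_mul_rest (h : IsSVD A U s V) :
    Aᴴ * leftRest hmn U = 0 := by
  rw [h.conjTranspose_eq hmn, Matrix.mul_assoc, leftVecs_mul_leftRest hmn h.U_unitary,
    Matrix.mul_zero]

theorem mul_diagonal_col {ι κ : Type*} [Fintype κ] [DecidableEq κ] (M : Matrix ι κ 𝕜)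
    (e : κ → 𝕜) (j : κ) : (M * Matrix.diagonal e).col j = e j • M.col j := by
  ext i
  simp [Matrix.col, mul_comm]

theorem IsSVD.mulVec_right (h : IsSVD A U s V) (j : Fin n) :
    A *ᵥ V.col j = (s j : 𝕜) • (leftVecs hmn U).col j := by
  rw [← mul_diagonal_col _ (fun j => (s j : 𝕜)), ← h.mul_right hmn]
  rfl

theorem IsSVD.conjTranspose_mulVec_left (h : IsSVD A U s V) (j : Fin n) :
    Aᴴ *ᵥ (leftVecs hmn U).col j = (s j : 𝕜) • V.col j := by
  rw [← mul_diagonal_col _ (fun j => (s j : 𝕜)), ← h.conjTranspose_mul_left hmn]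
  rfl

include hmn in
theorem IsSVD.le_norm (h : IsSVD A U s V) (j : Fin n) : s j ≤ ‖A‖ := by
  have h1 := normSq_mulVec_le A (V.col j)
  have hV : Vᴴ * V = 1 := Matrix.mem_unitaryGroup_iff'.mp h.V_unitary
  rw [h.mulVec_right hmn, normSq_smul, normSq_col_of_orthonormal hV,
    normSq_col_of_orthonormal (leftVecs_orthonormal hmn h.U_unitary), mul_one, mul_one,
    RCLike.norm_ofReal, sq_abs] at h1
  exact le_of_sq_le_sq h1 (norm_nonneg _)

include hmn in
/-- The scaled spectrum of the augmented matrix lies in `[-1, 1]`. -/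
theorem IsSVD.abs_eigVals_le (h : IsSVD A U s V) (c : Fin n ⊕ (Fin n ⊕ Fin (m - n))) :
    |eigVals s c| ≤ ‖A‖ := by
  rcases c with j | j | j
  · simpa [eigVals, abs_of_nonneg (h.s_nonneg j)] using h.le_norm hmn j
  · simpa [eigVals, abs_of_nonneg (h.s_nonneg j)] using h.le_norm hmn j
  · simp [eigVals]

theorem eigVecs_orthonormal (h : IsSVD A U s V) :
    (eigVecs hmn U V)ᴴ * eigVecs hmn U V = 1 := by
  have hV : Vᴴ * V = 1 := Matrix.mem_unitaryGroup_iff'.mp h.V_unitary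
  have h1 := leftVecs_orthonormal hmn h.U_unitary
  have h2 := leftRest_orthonormal hmn h.U_unitary
  have h3 := leftVecs_mul_leftRest hmn h.U_unitary
  have h4 : (leftRest hmn U)ᴴ * leftVecs hmn U = 0 := by
    simpa [Matrix.conjTranspose_mul] using congrArg Matrix.conjTranspose h3
  have h22 : (((√2 : ℝ) : 𝕜)) * ((√2 : ℝ) : 𝕜) = 2 := by
    rw [← RCLike.ofReal_mul, Real.mul_self_sqrt (by norm_num)]; exact RCLike.ofReal_ofNat 2
  have h20 : ((√2 : ℝ) : 𝕜) ≠ 0 := by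
    intro h0; rw [h0] at h22; norm_num at h22
  have hc : (((√2 : ℝ) : 𝕜))⁻¹ * ((√2 : ℝ) : 𝕜)⁻¹ = 2⁻¹ := by
    rw [← mul_inv, h22]
  have hc' : star ((((√2 : ℝ) : 𝕜))⁻¹) = (((√2 : ℝ) : 𝕜))⁻¹ := by
    simp
  have hh : (2⁻¹ : 𝕜) + 2⁻¹ = 1 := by norm_num
  rw [eigVecs, Matrix.conjTranspose_smul, Matrix.smul_mul, Matrix.mul_smul, smul_smul, hc', hc,
    Matrix.fromBlocks_conjTranspose, Matrix.fromBlocks_multiply,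
    Matrix.conjTranspose_fromCols_eq_fromRows_conjTranspose,
    Matrix.conjTranspose_fromCols_eq_fromRows_conjTranspose]
  simp only [Matrix.mul_fromCols, Matrix.fromRows_mul, hV, h1, h2, h3, h4,
    Matrix.conjTranspose_smul, Matrix.conjTranspose_neg, Matrix.conjTranspose_zero,
    Matrix.mul_neg, Matrix.neg_mul, Matrix.mul_smul, Matrix.smul_mul, Matrix.zero_mul,
    Matrix.mul_zero]
  have hr : star ((√2 : ℝ) : 𝕜) = ((√2 : ℝ) : 𝕜) := by simp
  rw [hr]
  generalize ((√2 : ℝ) : 𝕜) = w at *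
  ext (i | i | i) (j | j | j) <;>
    simp [Matrix.one_apply] <;> split_ifs <;> first | simp [h22] | norm_num

theorem augmented_mul_eigVecs (h : IsSVD A U s V) :
    augmented A * eigVecs hmn U V
      = eigVecs hmn U V * Matrix.diagonal (fun c => (eigVals (m := m) s c : 𝕜)) := by
  have h1 := h.mul_right hmn
  have h2 := h.conjTranspose_mul_left hmn
  have h3 := h.conjTranspose_mul_rest hmn
  rw [eigVecs, augmented, Matrix.smul_mul, Matrix.mul_smul, Matrix.fromBlocks_multiply]
  congr 1
  simp only [Matrix.mul_fromCols, Matrix.mul_neg, Matrix.mul_smul, Matrix.zero_mul, h1, h2, h3]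
  ext (i | i) (j | j | j) <;> simp [eigVals]

end SVD

/-! ### Subspace iteration -/

section Iteration

variable {𝕜 : Type*} [RCLike 𝕜] {ι κ : Type*} [Fintype ι] [Fintype κ] [DecidableEq ι]
  [DecidableEq κ]

/-- The columns of `Q` are eigenvectors of `S`; hence they are eigenvectors of every real polynomial
in `S`. -/
theorem aeval_mul_of_mul_eq {S : Matrix ι ι 𝕜} {Q : Matrix ι κ 𝕜} {x : κ → ℝ}
    (h : S * Q = Q * Matrix.diagonal (fun c => (x c : 𝕜))) (f : Polynomial ℝ) :
    Polynomial.aeval S f * Q = Q * Matrix.diagonal (fun c => ((f.eval (x c) : ℝ) : 𝕜)) := by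
  have hpow : ∀ l : ℕ, S ^ l * Q = Q * Matrix.diagonal (fun c => (((x c) ^ l : ℝ) : 𝕜)) := by
    intro l
    induction l with
    | zero => simp
    | succ l ih =>
      rw [pow_succ, Matrix.mul_assoc, h, ← Matrix.mul_assoc, ih, Matrix.mul_assoc,
        Matrix.diagonal_mul_diagonal]
      congr 2
      funext c
      push_cast
      ring
  induction f using Polynomial.induction_on' with
  | add f g hf hg =>
    rw [map_add, Matrix.add_mul, hf, hg, ← Matrix.mul_add, Matrix.diagonal_add]
    simp
  | monomial l a =>
    rw [Polynomial.aeval_monomial, ← Algebra.smul_def, Matrix.smul_mul, hpow,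
      ← Matrix.mul_smul]
    congr 1
    ext c c'
    by_cases hc : c = c'
    · subst hc; simp [RCLike.real_smul_eq_coe_mul]
    · simp [hc]

theorem pow_mul_of_mul_eq {P : Matrix ι ι 𝕜} {Q : Matrix ι κ 𝕜} {g : κ → ℝ}
    (h : P * Q = Q * Matrix.diagonal (fun c => (g c : 𝕜))) (k : ℕ) :
    P ^ k * Q = Q * Matrix.diagonal (fun c => ((g c ^ k : ℝ) : 𝕜)) := by
  simpa using aeval_mul_of_mul_eq h (Polynomial.X ^ k)

/-- Convergence of subspace iteration towards an eigenvector `q_i` with `i ≤ p`. The combination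
of the starting vectors whose component in `span (q_1, …, q_p)` is a multiple of `q_i` is sent by
`P ^ k` to `γ_i ^ k q_i` plus an error in `span (q_{p+1}, …)`. -/
theorem exists_normSq_sub_pow_mulVec_le {N p : ℕ} (hpN : p < N) {Q : Matrix ι κ 𝕜}
    (hQ : Qᴴ * Q = 1) (hQ' : Q * Qᴴ = 1) (lab : Fin N ≃ κ) {P : Matrix ι ι 𝕜} {g : κ → ℝ}
    (hPQ : P * Q = Q * Matrix.diagonal (fun c => (g c : 𝕜)))
    (hg0 : ∀ c, 0 ≤ g c) (hanti : Antitone fun j => g (lab j))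
    {X : Matrix ι (Fin p) 𝕜} (hinv : IsUnit ((firstCols Q lab p hpN.le)ᴴ * X)) (i : Fin p)
    (hi : 0 < g (lab (Fin.castLE hpN.le i))) (k : ℕ) :
    ∃ y : Fin p → 𝕜,
      normSq (Q.col (lab (Fin.castLE hpN.le i)) - P ^ k *ᵥ (X *ᵥ y))
        ≤ (g (lab ⟨p, hpN⟩) / g (lab (Fin.castLE hpN.le i))) ^ (2 * k)
          * ‖errMat (firstCols Q lab p hpN.le) (lastCols Q lab p) X‖ ^ 2 := by
  set c₀ := lab (Fin.castLE hpN.le i) with hc₀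
  set Mi := ((firstCols Q lab p hpN.le)ᴴ * X)⁻¹ with hMi
  set E := errMat (firstCols Q lab p hpN.le) (lastCols Q lab p) X with hE
  set z := X *ᵥ (Mi *ᵥ Pi.single i 1) with hz
  refine ⟨((((g c₀) ^ k)⁻¹ : ℝ) : 𝕜) • (Mi *ᵥ Pi.single i 1), ?_⟩
  rw [Matrix.mulVec_smul, Matrix.mulVec_smul, ← hz,
    ← normSq_mulVec_of_orthonormal (G := Qᴴ) (by rw [Matrix.conjTranspose_conjTranspose, hQ'])]
  have hQP : Qᴴ * P ^ k = Matrix.diagonal (fun c => ((g c ^ k : ℝ) : 𝕜)) * Qᴴ := by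
    calc Qᴴ * P ^ k = Qᴴ * P ^ k * (Q * Qᴴ) := by rw [hQ', Matrix.mul_one]
      _ = Qᴴ * (P ^ k * Q) * Qᴴ := by simp only [Matrix.mul_assoc]
      _ = _ := by
        rw [pow_mul_of_mul_eq hPQ, ← Matrix.mul_assoc, hQ, Matrix.one_mul]
  have hcol : Qᴴ *ᵥ Q.col c₀ = Pi.single c₀ 1 := by
    rw [← Matrix.mulVec_single_one, Matrix.mulVec_mulVec, hQ, Matrix.one_mulVec]
  have hcoord : ∀ c, (Qᴴ *ᵥ (Q.col c₀ - ((((g c₀) ^ k)⁻¹ : ℝ) : 𝕜) • (P ^ k *ᵥ z))) c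
      = (Pi.single c₀ 1 : κ → 𝕜) c
        - ((((g c₀) ^ k)⁻¹ * g c ^ k : ℝ) : 𝕜) * (Qᴴ *ᵥ z) c := by
    intro c
    rw [Matrix.mulVec_sub, hcol, Matrix.mulVec_smul, Matrix.mulVec_mulVec, hQP,
      ← Matrix.mulVec_mulVec, Pi.sub_apply, Pi.smul_apply, Matrix.mulVec_diagonal]
    simp [mul_assoc]
  have hfirst : ∀ j : Fin N, (hj : (j : ℕ) < p) →
      (Qᴴ *ᵥ z) (lab j) = (Pi.single i 1 : Fin p → 𝕜) ⟨j, hj⟩ := by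
    intro j hj
    have h1 : (firstCols Q lab p hpN.le)ᴴ *ᵥ z = Pi.single i 1 := by
      rw [hz, Matrix.mulVec_mulVec, Matrix.mulVec_mulVec, hMi,
        Matrix.mul_nonsing_inv _ ((Matrix.isUnit_iff_isUnit_det _).mp hinv), Matrix.one_mulVec]
    rw [← h1]
    rfl
  have hlast : ∀ j : {j : Fin N // p ≤ (j : ℕ)}, (Qᴴ *ᵥ z) (lab j) = E j i := by
    intro j
    have h1 : (lastCols Q lab p)ᴴ *ᵥ z = E.col i := by
      rw [hz, Matrix.mulVec_mulVec, Matrix.mulVec_mulVec, ← Matrix.mulVec_single_one]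
      rfl
    exact congrFun h1 j
  set ρ := g (lab ⟨p, hpN⟩) / g c₀ with hρ
  have hρ0 : 0 ≤ ρ := div_nonneg (hg0 _) hi.le
  have hzero : ∀ j : Fin N, (j : ℕ) < p →
      (Pi.single c₀ 1 : κ → 𝕜) (lab j)
        - ((((g c₀) ^ k)⁻¹ * g (lab j) ^ k : ℝ) : 𝕜) * (Qᴴ *ᵥ z) (lab j) = 0 := by
    intro j hj
    rw [hfirst j hj]
    by_cases hji : j = Fin.castLE hpN.le i
    · subst hji
      have h0 : g c₀ ^ k ≠ 0 := (pow_pos hi k).ne'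
      rw [← hc₀, inv_mul_cancel₀ h0]
      simp
    · have h1 : lab j ≠ c₀ := fun h => hji (lab.injective h)
      have h2 : (⟨j, hj⟩ : Fin p) ≠ i := fun h => hji (by rw [← h]; rfl)
      simp [h1, h2]
  rw [normSq_eq_sum, ← lab.sum_comp]
  simp only [hcoord]
  rw [← Finset.sum_filter_of_ne (p := fun j : Fin N => p ≤ (j : ℕ)) (fun j _ hj => by
      by_contra hlt
      exact hj (by rw [hzero j (not_le.mp hlt)]; simp)),
    Finset.sum_subtype (p := fun j : Fin N => p ≤ (j : ℕ)) _ (by simp)]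
  calc _ ≤ ∑ j : {j : Fin N // p ≤ (j : ℕ)}, ρ ^ (2 * k) * ‖E j i‖ ^ 2 := by
        refine Finset.sum_le_sum fun j _ => ?_
        have h1 : lab j ≠ c₀ := by
          intro h
          have h2 := congrArg Fin.val (lab.injective h)
          have h3 := j.2
          have h4 := i.2
          simp only [Fin.val_castLE] at h2
          omega
        rw [hlast j, Pi.single_eq_of_ne h1, zero_sub, norm_neg, norm_mul, mul_pow,
          RCLike.norm_ofReal]
        refine mul_le_mul_of_nonneg_right ?_ (sq_nonneg _)
        have h2 : (g c₀ ^ k)⁻¹ * g (lab j) ^ k = (g (lab j) / g c₀) ^ k := by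
          rw [div_pow]; ring
        have h3 : 0 ≤ g (lab j) / g c₀ := div_nonneg (hg0 _) hi.le
        rw [h2, abs_of_nonneg (pow_nonneg h3 k), ← pow_mul, mul_comm k 2]
        exact pow_le_pow_left₀ h3 (div_le_div_of_nonneg_right
          (hanti (show (⟨p, hpN⟩ : Fin N) ≤ j from j.2)) hi.le) _
    _ = ρ ^ (2 * k) * normSq (E.col i) := by
        rw [normSq_eq_sum, Finset.mul_sum]; rfl
    _ ≤ ρ ^ (2 * k) * ‖E‖ ^ 2 :=
        mul_le_mul_of_nonneg_left (normSq_col_le E i) (pow_nonneg hρ0 _)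

end Iteration

/-! ### The iterates of the solver -/

section Run

variable {𝕜 : Type*} [RCLike 𝕜] {m n : ℕ} {A : Matrix (Fin m) (Fin n) 𝕜} {a b : ℝ} {d p : ℕ}

theorem filterVal_nonneg (hA : 0 < ‖A‖) (hab : a ≤ b) (d : ℕ) {x : ℝ} (hx : |x| ≤ ‖A‖) :
    0 ≤ filterVal A a b d x := by
  refine cjSeries_eval_nonneg (div_le_div_of_nonneg_right hab hA.le) d ?_
  rw [Set.mem_Icc, ← abs_le, abs_div, abs_of_pos hA]
  exact (div_le_one hA).mpr hx

theorem approxProj_mul_eigVecs (hmn : n ≤ m) {U : Matrix (Fin m) (Fin m) 𝕜} {s : Fin n → ℝ}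
    {V : Matrix (Fin n) (Fin n) 𝕜} (h : IsSVD A U s V) (a b : ℝ) (d : ℕ) :
    approxProj A a b d * eigVecs hmn U V = eigVecs hmn U V
      * Matrix.diagonal (fun c => (filterVal A a b d (eigVals (m := m) s c) : 𝕜)) := by
  refine aeval_mul_of_mul_eq (x := fun c => eigVals (m := m) s c / ‖A‖) ?_ _
  rw [Matrix.smul_mul, augmented_mul_eigVecs hmn h, ← Matrix.mul_smul]
  congr 1
  ext c c'
  by_cases hc : c = c'
  · subst hc; simp [div_eq_inv_mul]
  · simp [hc]

/-- The iterates satisfy `P ^ k Q̃⁽⁰⁾ = Q̃⁽ᵏ⁾ (R⁽ᵏ⁾ ⋯ R⁽¹⁾)`; the triangular factors may be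
singular. -/
theorem Run.exists_pow_mul_eq (r : Run A a b d p) (k : ℕ) :
    ∃ T : Matrix (Fin p) (Fin p) 𝕜, approxProj A a b d ^ k * r.Qt 0 = r.Qt k * T := by
  induction k with
  | zero => exact ⟨1, by simp⟩
  | succ k ih =>
    obtain ⟨T, hT⟩ := ih
    refine ⟨r.R (k + 1) * T, ?_⟩
    have h := (r.iterate (k + 1) (by omega)).eq
    rw [Nat.add_sub_cancel] at h
    rw [pow_succ', Matrix.mul_assoc, hT, ← Matrix.mul_assoc, h, Matrix.mul_assoc]

/-- The space `span Q₁⁽ᵏ⁾ ⊕ span Q₂⁽ᵏ⁾` contains the column space of `Q̃⁽ᵏ⁾`. Hence both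
singular vectors are approximated from it as well as their concatenation is from `Q̃⁽ᵏ⁾`. -/
theorem Run.exists_normSq_add_eq (r : Run A a b d p) {k : ℕ} (hk : 1 ≤ k)
    (v : Fin n → 𝕜) (u : Fin m → 𝕜) (y : Fin p → 𝕜) {q : Fin n ⊕ Fin m → 𝕜}
    (hq : q = (((√2 : ℝ) : 𝕜)⁻¹) • Sum.elim v u) :
    ∃ w₁ w₂ : Fin p → 𝕜, normSq (v - r.Q₁ k *ᵥ w₁) + normSq (u - r.Q₂ k *ᵥ w₂)
      = 2 * normSq (q - r.Qt k *ᵥ y) := by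
  have h1 := (r.upper k hk).eq
  have h2 := (r.lower k hk).eq
  have h20 : ((√2 : ℝ) : 𝕜) ≠ 0 := by
    rw [Ne, RCLike.ofReal_eq_zero]; positivity
  refine ⟨((√2 : ℝ) : 𝕜) • (r.R₁ k *ᵥ y), ((√2 : ℝ) : 𝕜) • (r.R₂ k *ᵥ y), ?_⟩
  have hsq : (2 : ℝ) = ‖((√2 : ℝ) : 𝕜)‖ ^ 2 := by
    rw [RCLike.norm_ofReal, sq_abs, Real.sq_sqrt (by norm_num)]
  rw [← normSq_sumElim]
  conv_rhs => rw [hsq, ← normSq_smul]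
  congr 1
  rw [Matrix.mulVec_smul, Matrix.mulVec_smul, Matrix.mulVec_mulVec, Matrix.mulVec_mulVec,
    ← h1, ← h2, smul_sub, hq, smul_smul, mul_inv_cancel₀ h20, one_smul]
  funext c
  rcases c with c | c <;> rfl

end Run

/-! ### Angles between lines -/

section Angles

variable {𝕜 : Type*} [RCLike 𝕜] {ι κ : Type*} [Fintype ι] [Fintype κ]

theorem norm_star_dotProduct_comm (x y : ι → 𝕜) : ‖star x ⬝ᵥ y‖ = ‖star y ⬝ᵥ x‖ := by
  rw [← norm_star (star x ⬝ᵥ y), Matrix.star_dotProduct, star_star]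

theorem inner_toLp_eq (x y : ι → 𝕜) :
    inner 𝕜 (WithLp.toLp 2 x : EuclideanSpace 𝕜 ι) (WithLp.toLp 2 y) = star x ⬝ᵥ y := by
  rw [EuclideanSpace.inner_toLp_toLp, dotProduct_comm]

/-- The Cauchy--Schwarz inequality. -/
theorem norm_star_dotProduct_le (x y : ι → 𝕜) :
    ‖star x ⬝ᵥ y‖ ≤ √(normSq x) * √(normSq y) := by
  rw [← inner_toLp_eq, normSq, normSq, Real.sqrt_sq (norm_nonneg _), Real.sqrt_sq (norm_nonneg _)]
  exact norm_inner_le_norm _ _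

theorem norm_star_dotProduct_le_one {x y : ι → 𝕜} (hx : normSq x = 1) (hy : normSq y = 1) :
    ‖star x ⬝ᵥ y‖ ≤ 1 := by
  simpa [hx, hy] using norm_star_dotProduct_le x y

theorem sin_acuteAngle_sq {x y : ι → 𝕜} (hx : normSq x = 1) (hy : normSq y = 1) :
    Real.sin (acuteAngle x y) ^ 2 = 1 - ‖star x ⬝ᵥ y‖ ^ 2 := by
  have hx' : ‖(WithLp.toLp 2 x : EuclideanSpace 𝕜 ι)‖ = 1 := by
    rw [normSq] at hx; exact (pow_eq_one_iff_of_nonneg (norm_nonneg _) two_ne_zero).mp hx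
  have hy' : ‖(WithLp.toLp 2 y : EuclideanSpace 𝕜 ι)‖ = 1 := by
    rw [normSq] at hy; exact (pow_eq_one_iff_of_nonneg (norm_nonneg _) two_ne_zero).mp hy
  have h1 := norm_star_dotProduct_le_one hx hy
  rw [acuteAngle, hx', hy', inner_toLp_eq, mul_one, div_one, Real.sin_arccos,
    Real.sq_sqrt (by nlinarith [norm_nonneg (star x ⬝ᵥ y)])]

theorem normSq_sub_smul {u x : ι → 𝕜} (hu : normSq u = 1) (hx : normSq x = 1) :
    normSq (x - (star u ⬝ᵥ x) • u) = 1 - ‖star u ⬝ᵥ x‖ ^ 2 := by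
  have hu' : star u ⬝ᵥ u = 1 := by rw [← ofReal_normSq, hu, RCLike.ofReal_one]
  have hx' : star x ⬝ᵥ x = 1 := by rw [← ofReal_normSq, hx, RCLike.ofReal_one]
  have hxu : star x ⬝ᵥ u = star (star u ⬝ᵥ x) := by
    rw [Matrix.star_dotProduct]
  have h : ((normSq (x - (star u ⬝ᵥ x) • u) : ℝ) : 𝕜)
      = ((1 - ‖star u ⬝ᵥ x‖ ^ 2 : ℝ) : 𝕜) := by
    have hc := RCLike.conj_mul (star u ⬝ᵥ x)
    rw [starRingEnd_apply] at hc
    rw [ofReal_normSq, star_sub, star_smul, sub_dotProduct, dotProduct_sub, dotProduct_sub,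
      smul_dotProduct, smul_dotProduct, dotProduct_smul, dotProduct_smul, hu', hx', hxu]
    simp only [smul_eq_mul, mul_one]
    push_cast
    linear_combination -hc
  exact_mod_cast h

end Angles

/-! ### Rayleigh--Ritz estimates -/

section RayleighRitz

variable {𝕜 : Type*} [RCLike 𝕜]

/-- The matrix `[-τ, σ; σ, -τ]` has eigenvalues `σ - τ` and `-σ - τ`, of which the first is the
smaller in modulus. -/
theorem sq_sub_mul_le {σ τ : ℝ} (hσ : 0 ≤ σ) (hτ : 0 ≤ τ) {c d f g : 𝕜}
    (hf : (τ : 𝕜) * c + f = σ * d) (hg : (τ : 𝕜) * d + g = σ * c) :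
    (σ - τ) ^ 2 * (‖c‖ ^ 2 + ‖d‖ ^ 2) ≤ ‖f‖ ^ 2 + ‖g‖ ^ 2 := by
  have key : ∀ {x y e : 𝕜}, (τ : 𝕜) * x + e = σ * y →
      (σ * ‖y‖ - τ * ‖x‖) ^ 2 ≤ ‖e‖ ^ 2 := by
    intro x y e he
    have h := abs_norm_sub_norm_le ((σ : 𝕜) * y) ((τ : 𝕜) * x)
    rw [← he, add_sub_cancel_left, he, norm_mul, norm_mul, RCLike.norm_ofReal, RCLike.norm_ofReal,
      abs_of_nonneg hσ, abs_of_nonneg hτ] at h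
    exact sq_le_sq' (abs_le.mp h).1 (abs_le.mp h).2
  nlinarith [key hf, key hg, mul_nonneg (mul_nonneg hσ hτ) (sq_nonneg (‖c‖ - ‖d‖))]

variable {ι κ : Type*} [Fintype ι] [Fintype κ] {p : ℕ}

/-- The Rayleigh--Ritz estimate for a singular triplet `(σ, u, v)`. The column spaces of `G` and `H`
are the trial spaces, and the columns of `G`, `H` themselves are the Ritz vectors. -/
theorem one_sub_sq_add_one_sub_sq_le [DecidableEq ι] [DecidableEq κ] {A : Matrix ι κ 𝕜}
    {G : Matrix κ (Fin p) 𝕜} {H : Matrix ι (Fin p) 𝕜}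
    (hG : Gᴴ * G = 1) (hH : Hᴴ * H = 1) {τ : Fin p → ℝ} (hτ : ∀ j, 0 ≤ τ j)
    (hHAG : Hᴴ * A * G = Matrix.diagonal (fun j => (τ j : 𝕜))) {u : ι → 𝕜} {v : κ → 𝕜} {σ : ℝ}
    (hσ : 0 ≤ σ) (hu : normSq u = 1) (hv : normSq v = 1) (hAv : A *ᵥ v = (σ : 𝕜) • u)
    (hAu : Aᴴ *ᵥ u = (σ : 𝕜) • v) {α η : ℝ}
    (hα : ∀ x y, Gᴴ *ᵥ x = 0 → Hᴴ *ᵥ y = 0 →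
      normSq (Gᴴ *ᵥ (Aᴴ *ᵥ y)) + normSq (Hᴴ *ᵥ (A *ᵥ x)) ≤ α ^ 2 * (normSq x + normSq y))
    (i : Fin p) (hη : ∀ j, j ≠ i → 0 < η ∧ η ≤ |σ - τ j|) :
    (1 - ‖star u ⬝ᵥ H.col i‖ ^ 2) + (1 - ‖star v ⬝ᵥ G.col i‖ ^ 2)
      ≤ (1 + (α / η) ^ 2)
        * (normSq (v - G *ᵥ (Gᴴ *ᵥ v)) + normSq (u - H *ᵥ (Hᴴ *ᵥ u))) := by
  set c := Gᴴ *ᵥ v with hc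
  set e := Hᴴ *ᵥ u with he
  set x := v - G *ᵥ c with hx
  set y := u - H *ᵥ e with hy
  have hci : ‖star v ⬝ᵥ G.col i‖ = ‖c i‖ := by
    rw [norm_star_dotProduct_comm]; rfl
  have hei : ‖star u ⬝ᵥ H.col i‖ = ‖e i‖ := by
    rw [norm_star_dotProduct_comm]; rfl
  have hGHA : Gᴴ * Aᴴ * H = Matrix.diagonal (fun j => (τ j : 𝕜)) := by
    have := congrArg Matrix.conjTranspose hHAG
    rw [Matrix.conjTranspose_mul, Matrix.conjTranspose_mul, Matrix.conjTranspose_conjTranspose,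
      Matrix.diagonal_conjTranspose, ← Matrix.mul_assoc] at this
    rw [this]
    congr 1
    funext j
    simp
  have hf : ∀ j, (τ j : 𝕜) * c j + (Hᴴ *ᵥ (A *ᵥ x)) j = σ * e j := by
    intro j
    have h : Hᴴ *ᵥ (A *ᵥ v) = (Hᴴ * A * G) *ᵥ c + Hᴴ *ᵥ (A *ᵥ x) := by
      rw [hx, Matrix.mulVec_sub, Matrix.mulVec_sub, Matrix.mul_assoc, ← Matrix.mulVec_mulVec,
        ← Matrix.mulVec_mulVec]
      abel
    rw [hAv, Matrix.mulVec_smul, hHAG] at h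
    have := congrFun h j
    rw [Pi.add_apply, Matrix.mulVec_diagonal, Pi.smul_apply, smul_eq_mul] at this
    exact this.symm
  have hg : ∀ j, (τ j : 𝕜) * e j + (Gᴴ *ᵥ (Aᴴ *ᵥ y)) j = σ * c j := by
    intro j
    have h : Gᴴ *ᵥ (Aᴴ *ᵥ u) = (Gᴴ * Aᴴ * H) *ᵥ e + Gᴴ *ᵥ (Aᴴ *ᵥ y) := by
      rw [hy, Matrix.mulVec_sub, Matrix.mulVec_sub, Matrix.mul_assoc, ← Matrix.mulVec_mulVec,
        ← Matrix.mulVec_mulVec]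
      abel
    rw [hAu, Matrix.mulVec_smul, hGHA] at h
    have := congrFun h j
    rw [Pi.add_apply, Matrix.mulVec_diagonal, Pi.smul_apply, smul_eq_mul] at this
    exact this.symm
  have hvsplit := normSq_eq_residual_add hG v
  have husplit := normSq_eq_residual_add hH u
  rw [hv, ← hc, ← hx, normSq_eq_sum c, ← Finset.add_sum_erase _ _ (Finset.mem_univ i)] at hvsplit
  rw [hu, ← he, ← hy, normSq_eq_sum e, ← Finset.add_sum_erase _ _ (Finset.mem_univ i)] at husplit
  have hrest : ∑ j ∈ Finset.univ.erase i, (‖c j‖ ^ 2 + ‖e j‖ ^ 2)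
      ≤ (α / η) ^ 2 * (normSq x + normSq y) := by
    rcases (Finset.univ.erase i).eq_empty_or_nonempty with h0 | ⟨j₀, hj₀⟩
    · rw [h0, Finset.sum_empty]
      exact mul_nonneg (sq_nonneg _) (add_nonneg (normSq_nonneg _) (normSq_nonneg _))
    · have hη0 : 0 < η := (hη j₀ (Finset.ne_of_mem_erase hj₀)).1
      have h1 : η ^ 2 * ∑ j ∈ Finset.univ.erase i, (‖c j‖ ^ 2 + ‖e j‖ ^ 2)
          ≤ α ^ 2 * (normSq x + normSq y) := by
        calc _ ≤ ∑ j ∈ Finset.univ.erase i,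
                (‖(Hᴴ *ᵥ (A *ᵥ x)) j‖ ^ 2 + ‖(Gᴴ *ᵥ (Aᴴ *ᵥ y)) j‖ ^ 2) := by
              rw [Finset.mul_sum]
              refine Finset.sum_le_sum fun j hj => ?_
              refine le_trans ?_ (sq_sub_mul_le hσ (hτ j) (hf j) (hg j))
              refine mul_le_mul_of_nonneg_right ?_ (by positivity)
              rw [← sq_abs (σ - τ j)]
              exact pow_le_pow_left₀ hη0.le (hη j (Finset.ne_of_mem_erase hj)).2 2
          _ ≤ ∑ j, (‖(Hᴴ *ᵥ (A *ᵥ x)) j‖ ^ 2 + ‖(Gᴴ *ᵥ (Aᴴ *ᵥ y)) j‖ ^ 2) :=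
              Finset.sum_le_sum_of_subset_of_nonneg (Finset.erase_subset _ _)
                fun j _ _ => by positivity
          _ = normSq (Gᴴ *ᵥ (Aᴴ *ᵥ y)) + normSq (Hᴴ *ᵥ (A *ᵥ x)) := by
              rw [Finset.sum_add_distrib, ← normSq_eq_sum, ← normSq_eq_sum, add_comm]
          _ ≤ _ := hα x y (conjTranspose_mulVec_residual hG v)
              (conjTranspose_mulVec_residual hH u)
      rw [div_pow, div_mul_eq_mul_div, le_div_iff₀ (by positivity)]
      linarith
  rw [Finset.sum_add_distrib] at hrest
  rw [hci, hei]
  linarith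

/-- Here `(C, X)` and `(D, Y)` are the cosines and sines of two angles. If
`X ^ 2 + Y ^ 2 ≥ 1`, then `σ - τ ≤ σ ≤ N` suffices; this is where `τ ≥ 0` is needed. -/
theorem abs_sub_le_of_cos_sin {σ τ N C D X Y : ℝ} (hσ : 0 ≤ σ) (hσN : σ ≤ N) (hτ : 0 ≤ τ)
    (hC : 0 ≤ C) (hD : 0 ≤ D) (hX : 0 ≤ X) (hY : 0 ≤ Y) (hCX : C ^ 2 + X ^ 2 = 1)
    (hDY : D ^ 2 + Y ^ 2 = 1) (h : |τ - σ * (C * D)| ≤ N * (X * Y)) :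
    |σ - τ| ≤ N * (X ^ 2 + Y ^ 2) := by
  obtain ⟨h1, h2⟩ := abs_le.mp h
  have hN : 0 ≤ N := hσ.trans hσN
  have hsum : C * D + X * Y ≤ 1 := by nlinarith [sq_nonneg (C - D), sq_nonneg (X - Y)]
  have hCD : 0 ≤ C * D := mul_nonneg hC hD
  have hXY : 0 ≤ X * Y := mul_nonneg hX hY
  rw [abs_le]
  constructor
  · have h3 : N * (X * Y) ≤ N * (X ^ 2 + Y ^ 2) :=
      mul_le_mul_of_nonneg_left (by nlinarith [sq_nonneg (X - Y)]) hN
    nlinarith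
  · rcases le_total 1 (X ^ 2 + Y ^ 2) with h4 | h4
    · nlinarith
    · -- `(CD - XY) (CD + XY) = 1 - X² - Y²`, and `CD + XY ≤ 1`
      have hprod : (C * D - X * Y) * (C * D + X * Y) = 1 - X ^ 2 - Y ^ 2 := by
        have : C ^ 2 * D ^ 2 = (1 - X ^ 2) * (1 - Y ^ 2) := by
          rw [← eq_sub_of_add_eq hCX, ← eq_sub_of_add_eq hDY]
        linear_combination this
      have hle : X * Y ≤ C * D := by
        by_contra hlt
        push Not at hlt
        nlinarith
      have h5 : 1 - X ^ 2 - Y ^ 2 ≤ C * D - X * Y := by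
        rw [← hprod]
        exact mul_le_of_le_one_right (by linarith) hsum
      have h6 : σ * (1 - C * D) ≤ N * (1 - C * D) :=
        mul_le_mul_of_nonneg_right hσN (by linarith)
      have h7 : N * (1 - C * D + X * Y) ≤ N * (X ^ 2 + Y ^ 2) :=
        mul_le_mul_of_nonneg_left (by linarith) hN
      linarith

/-- The error of a nonnegative Rayleigh quotient `u'ᴴ A v'` as an approximate singular value is
quadratic in the sines of the angles between `u, u'` and between `v, v'`. -/
theorem abs_sub_rayleigh_le [DecidableEq κ] {A : Matrix ι κ 𝕜} {u u' : ι → 𝕜} {v v' : κ → 𝕜}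
    {σ τ : ℝ} (hσ : 0 ≤ σ) (hσN : σ ≤ ‖A‖) (hτ : 0 ≤ τ)
    (hu : normSq u = 1) (hv : normSq v = 1) (hu' : normSq u' = 1) (hv' : normSq v' = 1)
    (hAv : A *ᵥ v = (σ : 𝕜) • u) (hAu : Aᴴ *ᵥ u = (σ : 𝕜) • v)
    (hquot : star u' ⬝ᵥ A *ᵥ v' = (τ : 𝕜)) :
    |σ - τ| ≤ ‖A‖ * ((1 - ‖star u ⬝ᵥ u'‖ ^ 2) + (1 - ‖star v ⬝ᵥ v'‖ ^ 2)) := by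
  set e := star u ⬝ᵥ u' with he
  set c := star v ⬝ᵥ v' with hc
  set x := u' - e • u with hx
  set y := v' - c • v with hy
  have hx2 : normSq x = 1 - ‖e‖ ^ 2 := normSq_sub_smul hu hu'
  have hy2 : normSq y = 1 - ‖c‖ ^ 2 := normSq_sub_smul hv hv'
  have huu : star u ⬝ᵥ u = 1 := by rw [← ofReal_normSq, hu, RCLike.ofReal_one]
  have hvv : star v ⬝ᵥ v = 1 := by rw [← ofReal_normSq, hv, RCLike.ofReal_one]
  have hux : star u ⬝ᵥ x = 0 := by
    rw [hx, dotProduct_sub, dotProduct_smul, huu, smul_eq_mul, mul_one, ← he, sub_self]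
  have hvy : star v ⬝ᵥ y = 0 := by
    rw [hy, dotProduct_sub, dotProduct_smul, hvv, smul_eq_mul, mul_one, ← hc, sub_self]
  have hxu : star x ⬝ᵥ u = 0 := by
    rw [← norm_eq_zero, norm_star_dotProduct_comm, hux, norm_zero]
  have huAy : star u ⬝ᵥ A *ᵥ y = 0 := by
    rw [Matrix.dotProduct_mulVec, ← Matrix.conjTranspose_conjTranspose A, ← Matrix.star_mulVec,
      hAu, star_smul, smul_dotProduct, hvy, smul_zero]
  have hexp : (τ : 𝕜) = star e * c * σ + star x ⬝ᵥ A *ᵥ y := by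
    have h1 : u' = x + e • u := by rw [hx]; abel
    have h2 : v' = y + c • v := by rw [hy]; abel
    rw [← hquot]
    conv_lhs => rw [h1, h2]
    rw [Matrix.mulVec_add, Matrix.mulVec_smul, hAv, star_add, star_smul, add_dotProduct,
      dotProduct_add, dotProduct_add, smul_dotProduct, smul_dotProduct, dotProduct_smul,
      dotProduct_smul, dotProduct_smul, dotProduct_smul, hxu, huAy, huu]
    simp only [smul_eq_mul]
    ring
  have hcross : ‖star x ⬝ᵥ A *ᵥ y‖ ≤ ‖A‖ * (√(normSq x) * √(normSq y)) := by
    refine (norm_star_dotProduct_le _ _).trans ?_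
    have h1 : √(normSq (A *ᵥ y)) ≤ ‖A‖ * √(normSq y) := by
      rw [← Real.sqrt_sq (norm_nonneg A), ← Real.sqrt_mul (sq_nonneg _)]
      exact Real.sqrt_le_sqrt (normSq_mulVec_le A y)
    calc _ ≤ √(normSq x) * (‖A‖ * √(normSq y)) :=
          mul_le_mul_of_nonneg_left h1 (Real.sqrt_nonneg _)
      _ = _ := by ring
  have hmain := abs_sub_le_of_cos_sin (C := ‖e‖) (D := ‖c‖) hσ hσN hτ (norm_nonneg _)
    (norm_nonneg _) (Real.sqrt_nonneg (normSq x)) (Real.sqrt_nonneg (normSq y))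
    (by rw [Real.sq_sqrt (normSq_nonneg _), hx2]; ring)
    (by rw [Real.sq_sqrt (normSq_nonneg _), hy2]; ring) (by
      refine le_trans ?_ hcross
      -- `τ = |τ|`, so the phases of `e` and `c` drop out
      have h1 := abs_norm_sub_norm_le (τ : 𝕜) (star e * c * σ)
      rw [norm_mul, norm_mul, norm_star, RCLike.norm_ofReal, RCLike.norm_ofReal,
        abs_of_nonneg hτ, abs_of_nonneg hσ, mul_comm _ σ] at h1
      refine h1.trans (le_of_eq ?_)
      rw [hexp, add_sub_cancel_left])
  rwa [Real.sq_sqrt (normSq_nonneg _), Real.sq_sqrt (normSq_nonneg _), hx2, hy2] at hmain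

end RayleighRitz

/-! ### Ritz triplets of a run -/

section Run

variable {𝕜 : Type*} [RCLike 𝕜] {m n : ℕ} {A : Matrix (Fin m) (Fin n) 𝕜} {a b : ℝ} {d p : ℕ}

theorem mul_orthonormal {ι : Type*} [Fintype ι] {G : Matrix ι (Fin p) 𝕜}
    {W : Matrix (Fin p) (Fin p) 𝕜} (hG : Gᴴ * G = 1) (hW : W ∈ Matrix.unitaryGroup (Fin p) 𝕜) :
    (G * W)ᴴ * (G * W) = 1 := by
  have hW' : Wᴴ * W = 1 := Matrix.mem_unitaryGroup_iff'.mp hW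
  rw [Matrix.conjTranspose_mul, Matrix.mul_assoc, ← Matrix.mul_assoc Gᴴ, hG, Matrix.one_mul, hW']

theorem mul_unitary_mulVec {ι : Type*} [Fintype ι] (G : Matrix ι (Fin p) 𝕜)
    {W : Matrix (Fin p) (Fin p) 𝕜} (hW : W ∈ Matrix.unitaryGroup (Fin p) 𝕜) (x : ι → 𝕜) :
    (G * W) *ᵥ ((G * W)ᴴ *ᵥ x) = G *ᵥ (Gᴴ *ᵥ x) := by
  have hW' : W * Wᴴ = 1 := Matrix.mem_unitaryGroup_iff.mp hW
  rw [Matrix.mulVec_mulVec, Matrix.conjTranspose_mul, Matrix.mul_assoc, ← Matrix.mul_assoc W, hW',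
    Matrix.one_mul, Matrix.mulVec_mulVec]

/-- The Ritz vectors diagonalize the projected matrix. -/
theorem Run.ritz_diagonal (r : Run A a b d p) {k : ℕ} (hk : 1 ≤ k) :
    (r.Q₂ k * r.Ubar k)ᴴ * A * (r.Q₁ k * r.Vbar k)
      = Matrix.diagonal (fun j => (r.ritzVal k j : 𝕜)) := by
  have h := (r.svd k hk)
  have hU : (r.Ubar k)ᴴ * r.Ubar k = 1 := Matrix.mem_unitaryGroup_iff'.mp h.U_unitary
  have hD : (Matrix.of fun (i : Fin p) (j : Fin p) =>
      if (i : ℕ) = (j : ℕ) then (r.ritzVal k j : 𝕜) else 0)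
      = Matrix.diagonal (fun j => (r.ritzVal k j : 𝕜)) := by
    ext i j
    by_cases hij : i = j
    · subst hij; simp
    · have : (i : ℕ) ≠ j := fun h => hij (Fin.ext h)
      simp [hij, this]
  have hV : (r.Vbar k)ᴴ * r.Vbar k = 1 := Matrix.mem_unitaryGroup_iff'.mp h.V_unitary
  calc _ = (r.Ubar k)ᴴ * ((r.Q₂ k)ᴴ * A * r.Q₁ k) * r.Vbar k := by
        simp only [Matrix.conjTranspose_mul, Matrix.mul_assoc]
    _ = ((r.Ubar k)ᴴ * r.Ubar k) * Matrix.diagonal (fun j => (r.ritzVal k j : 𝕜))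
          * ((r.Vbar k)ᴴ * r.Vbar k) := by
        rw [h.eq, hD]; simp only [Matrix.mul_assoc]
    _ = _ := by rw [hU, hV, Matrix.one_mul, Matrix.mul_one]

/-- On vectors orthogonal to the trial spaces, `α⁽ᵏ⁾` bounds the part of `S_A` leading back into
them. -/
theorem Run.normSq_cross_le (r : Run A a b d p) {k : ℕ} (hk : 1 ≤ k)
    (x : Fin n → 𝕜) (y : Fin m → 𝕜) (hx : (r.Q₁ k * r.Vbar k)ᴴ *ᵥ x = 0)
    (hy : (r.Q₂ k * r.Ubar k)ᴴ *ᵥ y = 0) :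
    normSq ((r.Q₁ k * r.Vbar k)ᴴ *ᵥ (Aᴴ *ᵥ y)) + normSq ((r.Q₂ k * r.Ubar k)ᴴ *ᵥ (A *ᵥ x))
      ≤ r.alpha k ^ 2 * (normSq x + normSq y) := by
  have hV := (r.svd k hk).V_unitary
  have hU := (r.svd k hk).U_unitary
  have hG := mul_orthonormal (r.upper k hk).orthonormal hV
  have hH := mul_orthonormal (r.lower k hk).orthonormal hU
  have hx' : r.Q₁ k *ᵥ ((r.Q₁ k)ᴴ *ᵥ x) = 0 := by
    rw [← mul_unitary_mulVec _ hV, hx, Matrix.mulVec_zero]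
  have hy' : r.Q₂ k *ᵥ ((r.Q₂ k)ᴴ *ᵥ y) = 0 := by
    rw [← mul_unitary_mulVec _ hU, hy, Matrix.mulVec_zero]
  have hproj : ∀ (v : Fin n → 𝕜) (u : Fin m → 𝕜), r.projW k *ᵥ Sum.elim v u
      = Sum.elim (r.Q₁ k *ᵥ ((r.Q₁ k)ᴴ *ᵥ v)) (r.Q₂ k *ᵥ ((r.Q₂ k)ᴴ *ᵥ u)) := by
    intro v u
    rw [Run.projW, Run.basisW, Matrix.fromBlocks_conjTranspose, Matrix.fromBlocks_multiply,
      Matrix.fromBlocks_mulVec]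
    simp
  have h := normSq_mulVec_le (r.projW k * augmented A * (1 - r.projW k)) (Sum.elim x y)
  have h0 : r.projW k *ᵥ Sum.elim x y = 0 := by
    rw [hproj, hx', hy']; funext c; rcases c with c | c <;> rfl
  have haug : augmented A *ᵥ Sum.elim x y = Sum.elim (Aᴴ *ᵥ y) (A *ᵥ x) := by
    rw [augmented, Matrix.fromBlocks_mulVec]; simp
  rw [← Matrix.mulVec_mulVec, Matrix.sub_mulVec, Matrix.one_mulVec, h0, sub_zero,
    ← Matrix.mulVec_mulVec, haug, hproj, ← mul_unitary_mulVec (r.Q₁ k) hV,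
    ← mul_unitary_mulVec (r.Q₂ k) hU,
    normSq_sumElim, normSq_sumElim, normSq_mulVec_of_orthonormal hG,
    normSq_mulVec_of_orthonormal hH] at h
  exact h

/-- For `p = 1` there is no such `j`, and the value of `η` is irrelevant. -/
theorem Run.eta_pos_and_le (r : Run A a b d p) (k : ℕ) {σ : ℝ} {i : Fin p}
    (hη : ∀ j, j ≠ i → r.ritzVal k j ≠ σ) (j : Fin p) (hj : j ≠ i) :
    0 < r.eta k σ i ∧ r.eta k σ i ≤ |σ - r.ritzVal k j| := by
  have : Nonempty {j : Fin p // j ≠ i} := ⟨⟨j, hj⟩⟩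
  constructor
  · obtain ⟨j₁, hj₁⟩ := exists_eq_ciInf_of_finite
      (f := fun j : {j : Fin p // j ≠ i} => |σ - r.ritzVal k j|)
    rw [Run.eta, ← hj₁, abs_pos, sub_ne_zero]
    exact (hη j₁ j₁.2).symm
  · exact ciInf_le (f := fun j : {j : Fin p // j ≠ i} => |σ - r.ritzVal k j|)
      (Set.finite_range _).bddBelow ⟨j, hj⟩

end Run

end CJFeast

/-! ### The convergence theorem -/

open CJFeast

theorem theorem6p4 {𝕜 : Type*} [RCLike 𝕜] {m n : ℕ} (hmn : n ≤ m)
    (A : Matrix (Fin m) (Fin n) 𝕜)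
    -- a singular value decomposition of `A`
    (U : Matrix (Fin m) (Fin m) 𝕜) (s : Fin n → ℝ) (V : Matrix (Fin n) (Fin n) 𝕜)
    (hsvd : CJFeast.IsSVD A U s V)
    -- the interval, the series degree, the number of desired triplets, the subspace dimension
    (a b : ℝ) (ha : 0 < a) (hab : a < b) (hb : b ≤ ‖A‖)
    (d nsv p : ℕ) (hnp : nsv ≤ p) (hpN : p < m + n)
    -- the labeling `λ_1, …, λ_{m+n}` of the eigenvalues of the augmented matrix
    (lab : Fin (m + n) ≃ Fin n ⊕ (Fin n ⊕ Fin (m - n)))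
    (γ : Fin (m + n) → ℝ)
    (hγ : ∀ i, γ i = CJFeast.filterVal A a b d (CJFeast.eigVals s (lab i)))
    -- the labels `1, …, nsv` are those of the eigenvalues in `[a, b]`
    (hdesired : ∀ i : Fin (m + n),
      (i : ℕ) < nsv ↔ CJFeast.eigVals s (lab i) ∈ Set.Icc a b)
    -- `t i` is the position in the SVD of the desired singular value with label `i`
    (t : Fin nsv → Fin n)
    (ht : ∀ i : Fin nsv, lab (Fin.castLE (hnp.trans hpN.le) i) = Sum.inl (t i))
    -- `γ_1 ≥ γ_2 ≥ ⋯ ≥ γ_{m+n}` and `γ_{nsv} > γ_{p+1}`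
    (hanti : Antitone γ)
    (hgap : ∀ i : Fin (m + n), (i : ℕ) < nsv → γ ⟨p, hpN⟩ < γ i)
    -- the desired singular values are simple
    (hsimple : ∀ j : Fin n, s j ∈ Set.Icc a b → ∀ j' : Fin n, j' ≠ j → s j' ≠ s j)
    -- a run of the algorithm, with `Q_pᴴ Q̃⁽⁰⁾` invertible
    (r : CJFeast.Run A a b d p)
    (hinv : IsUnit
      ((CJFeast.firstCols (CJFeast.eigVecs hmn U V) lab p hpN.le)ᴴ * r.Qt 0))
    (k : ℕ) (hk : 1 ≤ k) (i : Fin nsv)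
    -- `η_i⁽ᵏ⁾ ≠ 0`
    (hη : ∀ j : Fin p, j ≠ Fin.castLE hnp i → r.ritzVal k j ≠ s (t i)) :
    (0 ≤ γ ⟨p, hpN⟩ / γ (Fin.castLE (hnp.trans hpN.le) i) ∧
      γ ⟨p, hpN⟩ / γ (Fin.castLE (hnp.trans hpN.le) i) < 1) ∧
    Real.sin (CJFeast.acuteAngle ((CJFeast.leftVecs hmn U).col (t i))
          (r.ritzLeft k (Fin.castLE hnp i))) ^ 2
        + Real.sin (CJFeast.acuteAngle (V.col (t i))
          (r.ritzRight k (Fin.castLE hnp i))) ^ 2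
      ≤ 2 * (1 + (r.alpha k / r.eta k (s (t i)) (Fin.castLE hnp i)) ^ 2)
        * (γ ⟨p, hpN⟩ / γ (Fin.castLE (hnp.trans hpN.le) i)) ^ (2 * k)
        * ‖CJFeast.errMat (CJFeast.firstCols (CJFeast.eigVecs hmn U V) lab p hpN.le)
            (CJFeast.lastCols (CJFeast.eigVecs hmn U V) lab p) (r.Qt 0)‖ ^ 2 ∧
    |s (t i) - r.ritzVal k (Fin.castLE hnp i)|
      ≤ 2 * ‖A‖ * (1 + (r.alpha k / r.eta k (s (t i)) (Fin.castLE hnp i)) ^ 2)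
        * (γ ⟨p, hpN⟩ / γ (Fin.castLE (hnp.trans hpN.le) i)) ^ (2 * k)
        * ‖CJFeast.errMat (CJFeast.firstCols (CJFeast.eigVecs hmn U V) lab p hpN.le)
            (CJFeast.lastCols (CJFeast.eigVecs hmn U V) lab p) (r.Qt 0)‖ ^ 2 := by
  have hA : 0 < ‖A‖ := ha.trans (hab.trans_le hb)
  set ρ := γ ⟨p, hpN⟩ / γ (Fin.castLE (hnp.trans hpN.le) i) with hρ
  set q := Fin.castLE hnp i with hq
  have hg0 : ∀ c, 0 ≤ filterVal A a b d (eigVals (m := m) s c) := fun c =>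
    filterVal_nonneg hA hab.le d (hsvd.abs_eigVals_le hmn c)
  have hγp : 0 ≤ γ ⟨p, hpN⟩ := by rw [hγ]; exact hg0 _
  have hlt : γ ⟨p, hpN⟩ < γ (Fin.castLE (hnp.trans hpN.le) i) := hgap _ i.2
  have hγi : 0 < γ (Fin.castLE (hnp.trans hpN.le) i) := hγp.trans_lt hlt
  refine ⟨⟨div_nonneg hγp hγi.le, (div_lt_one hγi).mpr hlt⟩, ?_⟩
  have hQ := eigVecs_orthonormal hmn hsvd
  have hQ' : eigVecs hmn U V * (eigVecs hmn U V)ᴴ = 1 :=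
    (Matrix.mul_eq_one_comm_of_equiv (lab.symm.trans
      ((finCongr (add_comm m n)).trans finSumFinEquiv.symm))).mp hQ
  set E := errMat (firstCols (eigVecs hmn U V) lab p hpN.le)
    (lastCols (eigVecs hmn U V) lab p) (r.Qt 0) with hE
  obtain ⟨y, hy⟩ := exists_normSq_sub_pow_mulVec_le hpN hQ hQ' lab
    (approxProj_mul_eigVecs hmn hsvd a b d) hg0
    (fun j j' hjj' => by simpa only [← hγ] using hanti hjj') hinv q
    (by rw [← hγ]; exact hγi) k
  obtain ⟨T, hT⟩ := r.exists_pow_mul_eq k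
  rw [← hγ, ← hγ, Matrix.mulVec_mulVec, hT, ← Matrix.mulVec_mulVec] at hy
  change normSq ((eigVecs hmn U V).col (lab (Fin.castLE (hnp.trans hpN.le) i))
    - r.Qt k *ᵥ (T *ᵥ y)) ≤ ρ ^ (2 * k) * ‖E‖ ^ 2 at hy
  set u := (leftVecs hmn U).col (t i) with hu
  set v := V.col (t i) with hv
  have hcol : (eigVecs hmn U V).col (lab (Fin.castLE (hnp.trans hpN.le) i))
      = (((√2 : ℝ) : 𝕜)⁻¹) • Sum.elim v u := by
    rw [ht]
    funext c
    rcases c with c | c <;> rfl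
  obtain ⟨w₁, w₂, hw⟩ := r.exists_normSq_add_eq hk v u (T *ᵥ y) hcol
  have hG := r.upper k hk
  have hH := r.lower k hk
  have hS := r.svd k hk
  have hGV := mul_orthonormal hG.orthonormal hS.V_unitary
  have hHU := mul_orthonormal hH.orthonormal hS.U_unitary
  have hV : Vᴴ * V = 1 := Matrix.mem_unitaryGroup_iff'.mp hsvd.V_unitary
  have hu1 : normSq u = 1 :=
    normSq_col_of_orthonormal (leftVecs_orthonormal hmn hsvd.U_unitary) _
  have hv1 : normSq v = 1 := normSq_col_of_orthonormal hV _
  have hu1' : normSq (r.ritzLeft k q) = 1 := normSq_col_of_orthonormal hHU _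
  have hv1' : normSq (r.ritzRight k q) = 1 := normSq_col_of_orthonormal hGV _
  have hres : normSq (v - (r.Q₁ k * r.Vbar k) *ᵥ ((r.Q₁ k * r.Vbar k)ᴴ *ᵥ v))
      + normSq (u - (r.Q₂ k * r.Ubar k) *ᵥ ((r.Q₂ k * r.Ubar k)ᴴ *ᵥ u))
      ≤ 2 * (ρ ^ (2 * k) * ‖E‖ ^ 2) := by
    rw [mul_unitary_mulVec _ hS.V_unitary, mul_unitary_mulVec _ hS.U_unitary]
    linarith [normSq_residual_le hG.orthonormal v w₁, normSq_residual_le hH.orthonormal u w₂]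
  have hangle := one_sub_sq_add_one_sub_sq_le hGV hHU hS.s_nonneg (r.ritz_diagonal hk)
    (hsvd.s_nonneg (t i)) hu1 hv1 (hsvd.mulVec_right hmn (t i))
    (hsvd.conjTranspose_mulVec_left hmn (t i)) (r.normSq_cross_le hk) q (r.eta_pos_and_le k hη)
  have hbound : (1 - ‖star u ⬝ᵥ r.ritzLeft k q‖ ^ 2) + (1 - ‖star v ⬝ᵥ r.ritzRight k q‖ ^ 2)
      ≤ 2 * (1 + (r.alpha k / r.eta k (s (t i)) q) ^ 2) * ρ ^ (2 * k) * ‖E‖ ^ 2 := by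
    refine hangle.trans ((mul_le_mul_of_nonneg_left hres (by positivity)).trans (le_of_eq ?_))
    ring
  have hquot : star (r.ritzLeft k q) ⬝ᵥ A *ᵥ r.ritzRight k q = (r.ritzVal k q : 𝕜) := by
    have h := congrFun (congrFun (r.ritz_diagonal hk) q) q
    rw [Matrix.diagonal_apply_eq, Matrix.mul_assoc] at h
    exact h
  constructor
  · rw [sin_acuteAngle_sq hu1 hu1', sin_acuteAngle_sq hv1 hv1']
    exact hbound
  · refine (abs_sub_rayleigh_le (hsvd.s_nonneg (t i)) (hsvd.le_norm hmn (t i))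
      (hS.s_nonneg q) hu1 hv1 hu1' hv1' (hsvd.mulVec_right hmn (t i))
      (hsvd.conjTranspose_mulVec_left hmn (t i)) hquot).trans ?_
    refine (mul_le_mul_of_nonneg_left hbound hA.le).trans (le_of_eq ?_)
    ring
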